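/- **Setting.** Let $d\in\{2,3\}$, $\nu>0$ and let $\Omega\subset\mathbb R^d$ be a bounded polyhedral domain. Let $\mathcal T_h$ be a conforming Delaunay triangulation of $\Omega$ (no vertex lies inside the circumscribed ball of an element), with element diameters $h_\triangle$ and $h=\max_\triangle h_\triangle$. For a vertex $p_i$ let $B_i$ be the box (Voronoi cell of $p_i$ among the vertices, restricted to $\overline\Omega$); the Voronoi cells of interior vertices are assumed to be contained in $\overline\Omega$. Write $F_{ij}=B_i\cap B_j$, $G_i$ for the set of $j\neq i$ with $|F_{ij}|>0$, $d_{ij}=|p_j-p_i|$, $n_{ij}=(p_j-p_i)/d_{ij}$, and $w_{ij}$ for the distance of $p_j$ from the hyperplane of $F_{ij}$ divided by $d_{ij}$. Let $m_i=\int_{\partial B_i\cap\partial\Omega}n\,ds=-\sum_{j\in G_i}|F_{ij}|n_{ij}$ if $p_i\in\partial\Omega$ and $m_i=0$ otherwise. *Mesh regularity* with constants $\sigma,\delta,\kappa>0$: each $\triangle$ contains a ball of radius $h_\triangle/\sigma$; $h_\triangle\ge\delta h$ for all $\triangle$; and for each interior vertex $p_i$ and each $j\in G_i$ one has $|B_i|\simeq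 h_\triangle^d$, and $d_{ij}\simeq h_\triangle$, $|F_{ij}|\simeq h_\triangle^{d-1}$, for some $\triangle$ meeting $B_i$, where $a\simeq b$ means $\kappa^{-1}b\le a\le\kappa b$. *Spaces.* $\mathcal V_h$ is the space of continuous piecewise linear functions on $\mathcal T_h$, $\boldsymbol{\mathcal V}_h=\mathcal V_h^d$, and $\boldsymbol{\mathcal V}_{h,0}$ its subspace of fields vanishing on $\partial\Omega$. The pressure space $\mathcal Q_h$ is any linear subspace of $\mathcal V_h$ (e.g. the functions of zero mean, or those vanishing on $\partial\Omega$). The lumping map is $\Pi_hv=\sum_iv(p_i)\chi_{B_i}$; below $v_i=v(p_i)$. *Norms.* With $\partial_{ij}v=(v_j-v_i)/d_{ij}$ (the normal derivative of a piecewise linear function across $F_{ij}$), sums over unordered faces, and $h_{ij}$ the largest diameter of an element meeting $F_{ij}$, $$|v|_*^2=\sum_{F_{ij}}d_{ij}|F_{ij}||\partial_{ij}v|^2,\qquad |q|_{\triangle,*}^2=\sum_{F_{ij}}h_{ij}^3d_{ij}|F_{ij}||\partial_{ij}q|^2,$$ $$|||(v,q)|||_{box}^2=|v|_{H^1}^2+\|\Pi_hq\|_{L^2}^2+|q|_{\triangle,*}^2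 .$$ *Forms.* Let $g_i(q)=\sum_{j\in G_i}|F_{ij}|(w_{ij}q_i+(1-w_{ij})q_j)n_{ij}+q_im_i$ and $D_i=\sum_{j\in G_i}\nu|F_{ij}|/d_{ij}$. Put $$a_B(u,\Pi_hv)=-\sum_i\sum_{j\in G_i}\nu\tfrac{|F_{ij}|}{d_{ij}}(u_j-u_i)\cdot v_i,\qquad \tilde b_B(\Pi_hv,p)=\sum_ig_i(p)\cdot v_i,$$ $$\tilde c_B(u,\Pi_hq)=\sum_i\Big(\sum_{j\in G_i}|F_{ij}|(w_{ij}u_i+(1-w_{ij})u_j)\cdot n_{ij}+u_i\cdot m_i\Big)q_i,$$ $$\tilde s_B(p,\Pi_hq)=\sum_i\sum_{j\in G_i}|F_{ij}|\Big[\big(w_{ij}D_i^{-1}g_i(p)+(1-w_{ij})D_j^{-1}g_j(p)\big)\cdot n_{ij}-\big(w_{ij}|B_i|D_i^{-1}+(1-w_{ij})|B_j|D_j^{-1}\big)\tfrac{p_j-p_i}{d_{ij}}\Big]q_i,$$ and let $\widetilde{\mathcal C}_B((u,p),(\Pi_hv,\Pi_hq))=a_B(u,\Pi_hv)+\tilde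 b_B(\Pi_hv,p)+\tilde c_B(u,\Pi_hq)+\tilde s_B(p,\Pi_hq)$. *The two conjectured properties*, with constants $\alpha,\beta>0$, for all $q\in\mathcal Q_h$: (C1) $\tilde s_B(q,\Pi_hq)\ge\alpha h^3|q|_*^2$; (C2) $\displaystyle\sup_{v\in\boldsymbol{\mathcal V}_{h,0}}\frac{\tilde c_B(v,\Pi_hq)}{|v|_*}+\tilde s_B(q,\Pi_hq)^{1/2}\ge\beta\|\Pi_hq\|_{L^2}$. **Theorem.** There is $\gamma>0$, depending only on $d,\Omega,\nu,\sigma,\delta,\kappa,\alpha,\beta$ (in particular independent of $h$), such that for every triangulation as above that satisfies the mesh regularity with constants $\sigma,\delta,\kappa$, and every $\mathcal Q_h\subseteq\mathcal V_h$ for which (C1) and (C2) hold with constants $\alpha,\beta$: 1. (discrete inf-sup condition) for all $u_h\in\boldsymbol{\mathcal V}_{h,0}$ and $p_h\in\mathcal Q_h$, $$\gamma\,|||(u_h,p_h)|||_{box}\le\sup_{(v_h,q_h)\in\boldsymbol{\mathcal V}_{h,0}\times\mathcal Q_h}\frac{\widetilde{\mathcal C}_B((u_h,p_h),(\Pi_hv_h,\Pi_hq_h))}{|||(v_h,q_h)|||_{box}};$$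 2. (well-posedness of the Rhie–Chow stabilized Box Method) for every $f\in L^2(\Omega)^d$ and $g_h\in\boldsymbol{\mathcal V}_h$ there is exactly one $(u_B,p_B)\in\boldsymbol{\mathcal V}_h\times\mathcal Q_h$ with $u_B=g_h$ on $\partial\Omega$, $$a_B(u_B,\Pi_hv_h)+\tilde b_B(\Pi_hv_h,p_B)=(f,\Pi_hv_h)_\Omega\quad\forall v_h\in\boldsymbol{\mathcal V}_{h,0},\qquad \tilde c_B(u_B,\Pi_hq_h)+\tilde s_B(p_B,\Pi_hq_h)=0\quad\forall q_h\in\mathcal Q_h,$$ and it satisfies $$\gamma\,|||(u_B-g_h,p_B)|||_{box}\le\sup_{(v_h,q_h)\in\boldsymbol{\mathcal V}_{h,0}\times\mathcal Q_h}\frac{(f,\Pi_hv_h)_\Omega-\widetilde{\mathcal C}_B((g_h,0),(\Pi_hv_h,\Pi_hq_h))}{|||(v_h,q_h)|||_{box}} .$$ -/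

import Mathlib

noncomputable section

namespace RCBM

/-- The Euclidean space `ℝ^d`. -/
abbrev E (d : ℕ) := EuclideanSpace ℝ (Fin d)

/-! ### Triangulations -/

/-- The closed simplex spanned by a finite set of points. -/
def simplex {d : ℕ} (T : Finset (E d)) : Set (E d) := convexHull ℝ (T : Set (E d))

/-- `𝒯` (a finite family of vertex sets) is a conforming triangulation of `Ω`: every element is a
nondegenerate `d`-simplex, two elements meet exactly in the simplex spanned by their common
vertices (possibly empty), and the elements cover the closure of `Ω`. -/
structure IsTriangulation {d : ℕ} (Ω : Set (E d)) (𝒯 : Finset (Finset (E d))) : Prop where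
  card_eq : ∀ T ∈ 𝒯, T.card = d + 1
  affineIndependent : ∀ T ∈ 𝒯, AffineIndependent ℝ (fun x : T => (x : E d))
  conforming : ∀ S ∈ 𝒯, ∀ T ∈ 𝒯,
    simplex S ∩ simplex T = convexHull ℝ ((S : Set (E d)) ∩ (T : Set (E d)))
  union_eq : ⋃ T ∈ 𝒯, simplex T = closure Ω

open Classical in
/-- The vertices of the triangulation. -/
def verts {d : ℕ} (𝒯 : Finset (Finset (E d))) : Finset (E d) := 𝒯.biUnion id

/-- The diameter `h_△` of an element. -/
def elemSize {d : ℕ} (T : Finset (E d)) : ℝ := Metric.diam (simplex T)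

/-- The mesh size `h = max h_△`. -/
def meshSize {d : ℕ} (𝒯 : Finset (Finset (E d))) : ℝ := sSup (elemSize '' (𝒯 : Set (Finset (E d))))

/-- Delaunay property: no vertex lies inside the circumscribed ball of an element. -/
def IsDelaunay {d : ℕ} (𝒯 : Finset (Finset (E d))) : Prop :=
  ∀ T ∈ 𝒯, ∀ (c : E d) (r : ℝ), (∀ p ∈ T, dist p c = r) → ∀ q ∈ verts 𝒯, r ≤ dist q c

/-! ### The dual Voronoi mesh -/

/-- The Voronoi cell in `ℝ^d` of the vertex `p`. -/
def voronoiCell {d : ℕ} (𝒯 : Finset (Finset (E d))) (p : E d) : Set (E d) :=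
  {x | ∀ q ∈ verts 𝒯, dist x p ≤ dist x q}

/-- The box `B_p`: the Voronoi cell of `p`, restricted to the closure of `Ω`. -/
def box {d : ℕ} (Ω : Set (E d)) (𝒯 : Finset (Finset (E d))) (p : E d) : Set (E d) :=
  voronoiCell 𝒯 p ∩ closure Ω

/-- The boxes of the interior vertices are full Voronoi cells, i.e. these do not leave the domain. -/
def InteriorBoxesInside {d : ℕ} (Ω : Set (E d)) (𝒯 : Finset (Finset (E d))) : Prop :=
  ∀ p ∈ verts 𝒯, p ∈ Ω → voronoiCell 𝒯 p ⊆ closure Ω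

/-- The volume `|B_p|`. -/
def boxVol {d : ℕ} (Ω : Set (E d)) (𝒯 : Finset (Finset (E d))) (p : E d) : ℝ :=
  (MeasureTheory.volume (box Ω 𝒯 p)).toReal

/-- The common part `F_pq` of two boxes. -/
def face {d : ℕ} (Ω : Set (E d)) (𝒯 : Finset (Finset (E d))) (p q : E d) : Set (E d) :=
  box Ω 𝒯 p ∩ box Ω 𝒯 q

/-- The `(d-1)`-dimensional measure `|F_pq|` (normalised Hausdorff measure). -/
def area {d : ℕ} (Ω : Set (E d)) (𝒯 : Finset (Finset (E d))) (p q : E d) : ℝ :=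
  (MeasureTheory.Measure.euclideanHausdorffMeasure (d - 1) (face Ω 𝒯 p q)).toReal

open Classical in
/-- The vertices `q` whose box shares a (nondegenerate) face with the box of `p`. -/
def nbrs {d : ℕ} (Ω : Set (E d)) (𝒯 : Finset (Finset (E d))) (p : E d) : Finset (E d) :=
  (verts 𝒯).filter fun q => q ≠ p ∧ 0 < area Ω 𝒯 p q

/-- The unit normal `n_pq` to `F_pq`, pointing out of `B_p`. -/
def normal {d : ℕ} (p q : E d) : E d := (dist p q)⁻¹ • (q - p)

/-- The interpolation weight `w_pq`: the distance of the centre `q` from (the hyperplane of) the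
face `F_pq`, divided by `d_pq = dist p q`. -/
def weight {d : ℕ} (p q : E d) : ℝ :=
  Metric.infDist q (AffineSubspace.perpBisector p q : Set (E d)) / dist p q

open Classical in
/-- The integral of the outer unit normal over the part of `∂B_p` lying on `∂Ω`. As the integral of
the normal over the whole of `∂B_p` vanishes, it is minus the sum of the `|F_pq| n_pq`. -/
def bdryNormal {d : ℕ} (Ω : Set (E d)) (𝒯 : Finset (Finset (E d))) (p : E d) : E d :=
  if p ∈ frontier Ω then - ∑ q ∈ nbrs Ω 𝒯 p, area Ω 𝒯 p q • normal p q else 0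

/-- The size `h_△` attached to a face: the largest diameter of an element that meets it. -/
def faceSize {d : ℕ} (Ω : Set (E d)) (𝒯 : Finset (Finset (E d))) (p q : E d) : ℝ :=
  sSup (elemSize '' {T | T ∈ 𝒯 ∧ (simplex T ∩ face Ω 𝒯 p q).Nonempty})

/-- Two-sided comparability `a ≃ b` with constant `κ`. -/
def Comparable (κ a b : ℝ) : Prop := κ⁻¹ * b ≤ a ∧ a ≤ κ * b

/-- Mesh regularity with constants `σ` (shape regularity), `δ` (quasi-uniformity) and `κ`
(comparability of the boxes of interior vertices, and of their faces, with a nearby element). -/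
structure MeshRegular {d : ℕ} (Ω : Set (E d)) (𝒯 : Finset (Finset (E d))) (σ δ κ : ℝ) : Prop where
  shape : ∀ T ∈ 𝒯, ∃ x, Metric.closedBall x (elemSize T / σ) ⊆ simplex T
  quasiUniform : ∀ T ∈ 𝒯, δ * meshSize 𝒯 ≤ elemSize T
  vol : ∀ p ∈ verts 𝒯, p ∈ Ω → ∃ T ∈ 𝒯, (simplex T ∩ box Ω 𝒯 p).Nonempty ∧
    Comparable κ (boxVol Ω 𝒯 p) (elemSize T ^ d)
  faces : ∀ p ∈ verts 𝒯, p ∈ Ω → ∀ q ∈ nbrs Ω 𝒯 p,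
    ∃ T ∈ 𝒯, (simplex T ∩ box Ω 𝒯 p).Nonempty ∧
      Comparable κ (dist p q) (elemSize T) ∧ Comparable κ (area Ω 𝒯 p q) (elemSize T ^ (d - 1))

/-! ### Discrete spaces and the lumping map -/

/-- Continuous functions on the closure of `Ω` that are affine on every element
(extended by zero outside the closure of `Ω`). -/
def Vh {d : ℕ} (Ω : Set (E d)) (𝒯 : Finset (Finset (E d))) : Submodule ℝ (E d → ℝ) where
  carrier := {v | ContinuousOn v (closure Ω) ∧
    (∀ T ∈ 𝒯, ∃ φ : E d →ᵃ[ℝ] ℝ, Set.EqOn v φ (simplex T)) ∧ ∀ x ∉ closure Ω, v x = 0}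
  add_mem' := by
    rintro v w ⟨hv, hv', hv0⟩ ⟨hw, hw', hw0⟩
    refine ⟨hv.add hw, fun T hT => ?_, fun x hx => by simp [hv0 x hx, hw0 x hx]⟩
    obtain ⟨φ, hφ⟩ := hv' T hT
    obtain ⟨ψ, hψ⟩ := hw' T hT
    exact ⟨φ + ψ, fun x hx => by simp [hφ hx, hψ hx]⟩
  zero_mem' := ⟨continuousOn_const, fun _ _ => ⟨0, fun _ _ => by simp⟩, fun _ _ => rfl⟩
  smul_mem' := by
    rintro c v ⟨hv, hv', hv0⟩
    refine ⟨hv.const_smul c, fun T hT => ?_, fun x hx => by simp [hv0 x hx]⟩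
    obtain ⟨φ, hφ⟩ := hv' T hT
    exact ⟨c • φ, fun x hx => by simp [hφ hx]⟩

/-- Discrete vector fields: all components are in `Vh`. -/
def VhVec {d : ℕ} (Ω : Set (E d)) (𝒯 : Finset (Finset (E d))) : Submodule ℝ (E d → E d) where
  carrier := {v | ∀ k, (fun x => v x k) ∈ Vh Ω 𝒯}
  add_mem' := fun hv hw k => (Vh Ω 𝒯).add_mem (hv k) (hw k)
  zero_mem' := fun _ => (Vh Ω 𝒯).zero_mem
  smul_mem' := fun c _ hv k => (Vh Ω 𝒯).smul_mem c (hv k)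

/-- Discrete vector fields that vanish on `∂Ω`. -/
def VhVec0 {d : ℕ} (Ω : Set (E d)) (𝒯 : Finset (Finset (E d))) : Submodule ℝ (E d → E d) where
  carrier := {v | v ∈ VhVec Ω 𝒯 ∧ ∀ x ∈ frontier Ω, v x = 0}
  add_mem' := fun hv hw =>
    ⟨(VhVec Ω 𝒯).add_mem hv.1 hw.1, fun x hx => by simp [hv.2 x hx, hw.2 x hx]⟩
  zero_mem' := ⟨(VhVec Ω 𝒯).zero_mem, fun _ _ => rfl⟩
  smul_mem' := fun c _ hv => ⟨(VhVec Ω 𝒯).smul_mem c hv.1, fun x hx => by simp [hv.2 x hx]⟩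

/-- The lumping map `Π_h v = ∑_p v(p) χ_{B_p}`. -/
def lump {d : ℕ} {M : Type*} [AddCommMonoid M] (Ω : Set (E d)) (𝒯 : Finset (Finset (E d)))
    (v : E d → M) : E d → M :=
  fun x => ∑ p ∈ verts 𝒯, Set.indicator (box Ω 𝒯 p) (fun _ => v p) x

/-! ### Norms -/

/-- The derivative `∂v/∂n_pq` across the face `F_pq` of a piecewise linear function: the slope of
`v` along the segment from `p` to `q`, extended constantly over the face. -/
def normalDeriv {d : ℕ} {M : Type*} [AddCommGroup M] [Module ℝ M] (p q : E d) (v : E d → M) : M :=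
  (dist p q)⁻¹ • (v q - v p)

/-- The seminorm `|v|_*`, where `|v|_*² = ∑_F d_pq ∫_F |∂v/∂n_pq|² ds`
(the double sum visits every face twice). -/
def starNorm {d : ℕ} {M : Type*} [NormedAddCommGroup M] [NormedSpace ℝ M] (Ω : Set (E d))
    (𝒯 : Finset (Finset (E d))) (v : E d → M) : ℝ :=
  √((1 / 2) * ∑ p ∈ verts 𝒯, ∑ q ∈ nbrs Ω 𝒯 p,
    dist p q * (area Ω 𝒯 p q * ‖normalDeriv p q v‖ ^ 2))

/-- The mesh-dependent seminorm `|q|_{△,*}`, with the additional weight `h_△³` on every face. -/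
def starNormMesh {d : ℕ} (Ω : Set (E d)) (𝒯 : Finset (Finset (E d))) (v : E d → ℝ) : ℝ :=
  √((1 / 2) * ∑ p ∈ verts 𝒯, ∑ q ∈ nbrs Ω 𝒯 p,
    faceSize Ω 𝒯 p q ^ 3 * dist p q * (area Ω 𝒯 p q * ‖normalDeriv p q v‖ ^ 2))

/-- The `H¹(Ω)` seminorm of a piecewise smooth continuous vector field (its weak gradient is its
almost everywhere defined classical gradient). -/
def h1Seminorm {d : ℕ} (Ω : Set (E d)) (v : E d → E d) : ℝ :=
  √(∑ k : Fin d, ∫ x in Ω, ‖fderiv ℝ (fun y => v y k) x‖ ^ 2)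

/-- The `L²(Ω)` norm of a scalar function. -/
def l2Norm {d : ℕ} (Ω : Set (E d)) (q : E d → ℝ) : ℝ := √(∫ x in Ω, q x ^ 2)

/-- The norm `|||(v,q)|||_box`. -/
def boxNorm {d : ℕ} (Ω : Set (E d)) (𝒯 : Finset (Finset (E d))) (v : E d → E d) (q : E d → ℝ) :
    ℝ :=
  √(h1Seminorm Ω v ^ 2 + l2Norm Ω (lump Ω 𝒯 q) ^ 2 + starNormMesh Ω 𝒯 q ^ 2)

/-! ### Discrete bilinear forms

The second (first, for `bB`) argument is a box-wise constant function `w`; its value on the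
box `B_p` is `w p`. -/

/-- `a_B(v,w) = -∑_p ∑_q ν |F_pq|/d_pq (v_q - v_p) · w_p`. -/
def aB {d : ℕ} (Ω : Set (E d)) (𝒯 : Finset (Finset (E d))) (ν : ℝ) (v w : E d → E d) : ℝ :=
  - ∑ p ∈ verts 𝒯, ∑ q ∈ nbrs Ω 𝒯 p,
    ν * (area Ω 𝒯 p q / dist p q) * inner ℝ (v q - v p) (w p)

/-- The Gauss–Green approximation `|B_p| ∇_{h,p} r` of `∫_{∂B_p} r n ds`: linear interpolation on
the faces shared with other boxes, the value `r p` on the part of `∂B_p` lying on `∂Ω`. -/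
def gaussGreen {d : ℕ} (Ω : Set (E d)) (𝒯 : Finset (Finset (E d))) (r : E d → ℝ) (p : E d) :
    E d :=
  ∑ q ∈ nbrs Ω 𝒯 p,
    (area Ω 𝒯 p q * (weight p q * r p + (1 - weight p q) * r q)) • normal p q
  + r p • bdryNormal Ω 𝒯 p

/-- `b̃_B(w,r)`. -/
def bB {d : ℕ} (Ω : Set (E d)) (𝒯 : Finset (Finset (E d))) (w : E d → E d) (r : E d → ℝ) : ℝ :=
  ∑ p ∈ verts 𝒯, inner ℝ (gaussGreen Ω 𝒯 r p) (w p)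

/-- `c̃_B(v,w)`: the sum over the boxes of the interpolated fluxes of `v`, times `w`. -/
def cB {d : ℕ} (Ω : Set (E d)) (𝒯 : Finset (Finset (E d))) (v : E d → E d) (w : E d → ℝ) : ℝ :=
  ∑ p ∈ verts 𝒯,
    (∑ q ∈ nbrs Ω 𝒯 p,
        area Ω 𝒯 p q * inner ℝ (weight p q • v p + (1 - weight p q) • v q) (normal p q)
      + inner ℝ (v p) (bdryNormal Ω 𝒯 p)) * w p

/-- The diagonal coefficient `D_p = ∑_q ν |F_pq|/d_pq` of the matrix of `a_B`. -/
def diagA {d : ℕ} (Ω : Set (E d)) (𝒯 : Finset (Finset (E d))) (ν : ℝ) (p : E d) : ℝ :=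
  ∑ q ∈ nbrs Ω 𝒯 p, ν * (area Ω 𝒯 p q / dist p q)

/-- The Rhie–Chow stabilization `s̃_B(r,w)`. -/
def sB {d : ℕ} (Ω : Set (E d)) (𝒯 : Finset (Finset (E d))) (ν : ℝ) (r w : E d → ℝ) : ℝ :=
  ∑ p ∈ verts 𝒯, ∑ q ∈ nbrs Ω 𝒯 p,
    area Ω 𝒯 p q *
      inner ℝ ((weight p q * (diagA Ω 𝒯 ν p)⁻¹) • gaussGreen Ω 𝒯 r p
        + ((1 - weight p q) * (diagA Ω 𝒯 ν q)⁻¹) • gaussGreen Ω 𝒯 r q) (normal p q) * w p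
  - ∑ p ∈ verts 𝒯, ∑ q ∈ nbrs Ω 𝒯 p,
    area Ω 𝒯 p q *
      (weight p q * boxVol Ω 𝒯 p * (diagA Ω 𝒯 ν p)⁻¹
        + (1 - weight p q) * boxVol Ω 𝒯 q * (diagA Ω 𝒯 ν q)⁻¹) *
      ((r q - r p) / dist p q) * w p

/-- The compact form `C̃_B((u,p),(w,z))`, for box-wise constant `w` and `z`. -/
def CB {d : ℕ} (Ω : Set (E d)) (𝒯 : Finset (Finset (E d))) (ν : ℝ)
    (u : E d → E d) (p : E d → ℝ) (w : E d → E d) (z : E d → ℝ) : ℝ :=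
  aB Ω 𝒯 ν u w + bB Ω 𝒯 w p + cB Ω 𝒯 u z + sB Ω 𝒯 ν p z

/-! ### The two conjectured properties of the Rhie–Chow term -/

/-- Coercivity of the Rhie–Chow term on `Qh`, with constant `α`. -/
def RhieChowCoercive {d : ℕ} (Ω : Set (E d)) (𝒯 : Finset (Finset (E d))) (ν : ℝ)
    (Qh : Submodule ℝ (E d → ℝ)) (α : ℝ) : Prop :=
  ∀ q ∈ Qh, α * (meshSize 𝒯 ^ 3 * starNorm Ω 𝒯 q ^ 2) ≤ sB Ω 𝒯 ν q (lump Ω 𝒯 q)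

/-- Generalized inf-sup condition for the Rhie–Chow term on `Qh`, with constant `β`. -/
def RhieChowInfSup {d : ℕ} (Ω : Set (E d)) (𝒯 : Finset (Finset (E d))) (ν : ℝ)
    (Qh : Submodule ℝ (E d → ℝ)) (β : ℝ) : Prop :=
  ∀ q ∈ Qh, β * l2Norm Ω (lump Ω 𝒯 q) ≤
    (⨆ v : VhVec0 Ω 𝒯, cB Ω 𝒯 v (lump Ω 𝒯 q) / starNorm Ω 𝒯 (v : E d → E d))
      + √(sB Ω 𝒯 ν q (lump Ω 𝒯 q))

/-! ### The Rhie–Chow stabilized Box Method -/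

/-- The right-hand side `(f, w)_Ω`. -/
def load {d : ℕ} (Ω : Set (E d)) (f w : E d → E d) : ℝ := ∫ x in Ω, inner ℝ (f x) (w x)

/-- `(u,p)` solves the Rhie–Chow stabilized Box Method with force `f`, boundary values those of
the discrete field `g`, and pressure space `Qh`. -/
structure IsSolution {d : ℕ} (Ω : Set (E d)) (𝒯 : Finset (Finset (E d))) (ν : ℝ)
    (Qh : Submodule ℝ (E d → ℝ)) (f g : E d → E d) (u : E d → E d) (p : E d → ℝ) : Prop where
  velocity_mem : u ∈ VhVec Ω 𝒯
  boundary : ∀ x ∈ frontier Ω, u x = g x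
  pressure_mem : p ∈ Qh
  momentum : ∀ v ∈ VhVec0 Ω 𝒯,
    aB Ω 𝒯 ν u (lump Ω 𝒯 v) + bB Ω 𝒯 (lump Ω 𝒯 v) p = load Ω f (lump Ω 𝒯 v)
  mass : ∀ q ∈ Qh, cB Ω 𝒯 u (lump Ω 𝒯 q) + sB Ω 𝒯 ν p (lump Ω 𝒯 q) = 0

end RCBM

end

noncomputable section

namespace RCBM

open MeasureTheory

/-! Write X for the box norm of (u,p) and S for the supremum over test pairs. For velocities
vanishing on the boundary, the discrete gradient and divergence are skew-adjoint (`bB_eq_neg_cB`).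
The faces lie on perpendicular bisectors, so every interpolation weight is 1/2, and the
area-weighted normals of an interior box sum to zero (`sum_area_normal_eq_zero`). Testing with (u,p)
itself therefore gives ν|u|_*² + s(p,p) ≤ S·X (`CB_self`), and (C1) turns s(p,p) into control of the
mesh-weighted pressure seminorm.

The L² part of the pressure comes from (C2). Testing with (-v,0) bounds c(v,p) by (S·C +
ν|u|_*)|v|_* (`CB_velocity`), hence β‖Πp‖ ≤ S·C + √s + ν|u|_*. Collecting the squares gives X² ≤
M·S·X + D·S², so X ≤ (M+D+1)S with constants independent of the mesh (`exists_infSup`).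

The geometric core is |v|_{H¹} ≤ C|v|_*, uniformly in the mesh (`exists_h1Seminorm_le`). The H¹
seminorm sees jumps of v along all edges of elements, whereas |v|_* sees only pairs whose boxes
share a face of positive area, and an edge may have a degenerate dual face. The two endpoints of an
edge are nevertheless joined by a chain of nearby cells with nondegenerate common faces
(`voronoiGraph_reachable`): otherwise nearby cells would fall into two closed families meeting in a
set of zero (d-1)-measure, and a slightly shifted segment would cross from one family to the other
without meeting that set. A volume count bounds the length of the chain.

For well-posedness, all spaces are finite dimensional. The inf-sup inequality makes the map into the
dual injective, hence bijective, and the stability estimate is the same inequality with the form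
replaced by the right-hand side. -/

theorem mem_verts {d : ℕ} {𝒯 : Finset (Finset (E d))} {p : E d} :
    p ∈ verts 𝒯 ↔ ∃ T ∈ 𝒯, p ∈ T := by
  simp [verts]

theorem subset_simplex {d : ℕ} (T : Finset (E d)) : (T : Set (E d)) ⊆ simplex T :=
  subset_convexHull ℝ _

theorem isCompact_simplex {d : ℕ} (T : Finset (E d)) : IsCompact (simplex T) :=
  T.finite_toSet.isCompact_convexHull ℝ

theorem isBounded_simplex {d : ℕ} (T : Finset (E d)) : Bornology.IsBounded (simplex T) :=
  (isCompact_simplex T).isBounded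

/-! ### Boxes, faces, and the diffusion form as an energy product -/

section Basic

variable {d : ℕ} {Ω : Set (E d)} {𝒯 : Finset (Finset (E d))}

theorem IsTriangulation.simplex_subset (h : IsTriangulation Ω 𝒯) {T : Finset (E d)}
    (hT : T ∈ 𝒯) : simplex T ⊆ closure Ω := by
  rw [← h.union_eq]
  exact Set.subset_biUnion_of_mem (u := fun T => simplex T) hT

theorem IsTriangulation.vert_mem_closure (h : IsTriangulation Ω 𝒯) {p : E d}
    (hp : p ∈ verts 𝒯) : p ∈ closure Ω := by
  obtain ⟨T, hT, hpT⟩ := mem_verts.1 hp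
  exact h.simplex_subset hT (subset_simplex T hpT)

theorem mem_box_iff (h : IsTriangulation Ω 𝒯) {p q : E d} (hp : p ∈ verts 𝒯)
    (hq : q ∈ verts 𝒯) : p ∈ box Ω 𝒯 q ↔ p = q := by
  constructor
  · intro hb
    have := hb.1 p hp
    rw [dist_self] at this
    exact dist_le_zero.1 this
  · rintro rfl
    exact ⟨fun r _ => by rw [dist_self]; exact dist_nonneg, h.vert_mem_closure hp⟩

/-- Boxes overlap on their common faces, where the lumped function adds several values. A vertex
lies in its own box only, so there the value is the intended one; the discrete forms evaluate their
test functions only at vertices. -/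
theorem lump_vert {M : Type*} [AddCommMonoid M] (h : IsTriangulation Ω 𝒯) (v : E d → M)
    {p : E d} (hp : p ∈ verts 𝒯) : lump Ω 𝒯 v p = v p := by
  unfold lump
  rw [Finset.sum_eq_single_of_mem p hp]
  · rw [Set.indicator_of_mem ((mem_box_iff h hp hp).2 rfl)]
  · intro q hq hqp
    rw [Set.indicator_of_notMem]
    rw [mem_box_iff h hp hq]
    exact fun e => hqp e.symm

theorem face_comm (p q : E d) : face Ω 𝒯 p q = face Ω 𝒯 q p := Set.inter_comm _ _

theorem area_comm (p q : E d) : area Ω 𝒯 p q = area Ω 𝒯 q p := by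
  unfold area; rw [face_comm]

theorem area_nonneg (p q : E d) : 0 ≤ area Ω 𝒯 p q := ENNReal.toReal_nonneg

theorem normal_comm (p q : E d) : normal p q = - normal q p := by
  unfold normal
  rw [dist_comm, ← smul_neg, neg_sub]

theorem mem_nbrs {p q : E d} :
    q ∈ nbrs Ω 𝒯 p ↔ q ∈ verts 𝒯 ∧ q ≠ p ∧ 0 < area Ω 𝒯 p q := by
  simp [nbrs]

theorem mem_nbrs_comm {p q : E d} (hp : p ∈ verts 𝒯) (hq : q ∈ nbrs Ω 𝒯 p) :
    p ∈ nbrs Ω 𝒯 q := by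
  rw [mem_nbrs] at hq ⊢
  exact ⟨hp, hq.2.1.symm, by rw [area_comm]; exact hq.2.2⟩

/-- A sum over ordered pairs of neighbouring boxes may be reordered. -/
theorem sum_nbrs_comm {M : Type*} [AddCommMonoid M] (F : E d → E d → M) :
    ∑ p ∈ verts 𝒯, ∑ q ∈ nbrs Ω 𝒯 p, F p q = ∑ p ∈ verts 𝒯, ∑ q ∈ nbrs Ω 𝒯 p, F q p := by
  apply Finset.sum_comm'
  intro p q
  constructor
  · rintro ⟨hp, hq⟩
    exact ⟨mem_nbrs_comm hp hq, (mem_nbrs.1 hq).1⟩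
  · rintro ⟨hp, hq⟩
    exact ⟨(mem_nbrs.1 hp).1, mem_nbrs_comm hq hp⟩

/-- The midpoint realizes the distance from q to the bisector: any x equidistant from p and q
satisfies d(p,q) ≤ 2 d(x,q). -/
theorem weight_eq {p q : E d} (h : q ≠ p) : weight p q = 1 / 2 := by
  have hpos : 0 < dist p q := dist_pos.2 h.symm
  have key : Metric.infDist q (AffineSubspace.perpBisector p q : Set (E d)) = dist p q / 2 := by
    apply le_antisymm
    · refine (Metric.infDist_le_dist_of_mem
        (AffineSubspace.midpoint_mem_perpBisector p q)).trans (le_of_eq ?_)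
      rw [dist_right_midpoint]
      simp; ring
    · rw [Metric.le_infDist ⟨_, AffineSubspace.midpoint_mem_perpBisector p q⟩]
      intro x hx
      have hx' := AffineSubspace.mem_perpBisector_iff_dist_eq.1 hx
      have := dist_triangle p x q
      rw [dist_comm p x, hx', dist_comm x q] at this
      linarith
  rw [weight, key]
  field_simp

theorem starNorm_sq {M : Type*} [NormedAddCommGroup M] [NormedSpace ℝ M] (v : E d → M) :
    starNorm Ω 𝒯 v ^ 2 = (1 / 2) * ∑ p ∈ verts 𝒯, ∑ q ∈ nbrs Ω 𝒯 p,
      area Ω 𝒯 p q / dist p q * ‖v q - v p‖ ^ 2 := by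
  have e : ∀ p q : E d, dist p q * (area Ω 𝒯 p q * ‖normalDeriv p q v‖ ^ 2)
      = area Ω 𝒯 p q / dist p q * ‖v q - v p‖ ^ 2 := by
    intro p q
    unfold normalDeriv
    rw [norm_smul, norm_inv, Real.norm_of_nonneg dist_nonneg]
    rcases eq_or_ne (dist p q) 0 with h | h
    · simp [h]
    · field_simp
  unfold starNorm
  simp only [e]
  apply Real.sq_sqrt
  apply mul_nonneg (by norm_num)
  exact Finset.sum_nonneg fun p _ => Finset.sum_nonneg fun q _ =>
    mul_nonneg (div_nonneg (area_nonneg p q) dist_nonneg) (sq_nonneg _)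

theorem starNorm_nonneg {M : Type*} [NormedAddCommGroup M] [NormedSpace ℝ M] (v : E d → M) :
    0 ≤ starNorm Ω 𝒯 v := Real.sqrt_nonneg _

/-- The symmetric form of `a_B`. -/
theorem aB_eq (ν : ℝ) (v w : E d → E d) :
    aB Ω 𝒯 ν v w = ν * ((1 / 2) * ∑ p ∈ verts 𝒯, ∑ q ∈ nbrs Ω 𝒯 p,
      area Ω 𝒯 p q / dist p q * inner ℝ (v q - v p) (w q - w p)) := by
  have e : ∀ p q : E d, ν * (area Ω 𝒯 q p / dist q p) * inner ℝ (v p - v q) (w q)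
      = - (ν * (area Ω 𝒯 p q / dist p q) * inner ℝ (v q - v p) (w q)) := by
    intro p q
    rw [area_comm q p, dist_comm q p, ← neg_sub (v q) (v p), inner_neg_left]; ring
  -- Each face is visited from both sides. Averaging the sum with its swapped copy replaces the test
  -- value at p by half of a difference of test values.
  have h := (sum_nbrs_comm (Ω := Ω) (𝒯 := 𝒯) fun p q =>
    ν * (area Ω 𝒯 p q / dist p q) * inner ℝ (v q - v p) (w p)).trans
    (Finset.sum_congr rfl fun p _ => Finset.sum_congr rfl fun q _ => e p q)
  simp only [Finset.sum_neg_distrib] at h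
  have : aB Ω 𝒯 ν v w = (1 / 2) * (aB Ω 𝒯 ν v w + aB Ω 𝒯 ν v w) := by ring
  rw [this]
  nth_rewrite 1 [aB]
  rw [h, neg_neg, aB, ← sub_eq_add_neg]
  simp only [← Finset.sum_sub_distrib, Finset.mul_sum]
  refine Finset.sum_congr rfl fun p _ => Finset.sum_congr rfl fun q _ => ?_
  rw [inner_sub_right]; ring

theorem aB_self (ν : ℝ) (v : E d → E d) : aB Ω 𝒯 ν v v = ν * starNorm Ω 𝒯 v ^ 2 := by
  rw [aB_eq, starNorm_sq]
  simp only [real_inner_self_eq_norm_sq]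

/-- Cauchy–Schwarz inequality for `a_B`. -/
theorem aB_le {ν : ℝ} (hν : 0 < ν) (v w : E d → E d) :
    |aB Ω 𝒯 ν v w| ≤ ν * (starNorm Ω 𝒯 v * starNorm Ω 𝒯 w) := by
  have hb : ∀ t : ℝ, 0 ≤ starNorm Ω 𝒯 w ^ 2 * (t * t)
      + (2 * (aB Ω 𝒯 ν v w / ν)) * t + starNorm Ω 𝒯 v ^ 2 := by
    intro t
    have h : starNorm Ω 𝒯 (v + t • w) ^ 2 = starNorm Ω 𝒯 w ^ 2 * (t * t)
      + (2 * (aB Ω 𝒯 ν v w / ν)) * t + starNorm Ω 𝒯 v ^ 2 := by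
      rw [aB_eq, mul_div_cancel_left₀ _ hν.ne', starNorm_sq, starNorm_sq, starNorm_sq]
      simp only [Finset.mul_sum, Finset.sum_mul, ← Finset.sum_add_distrib]
      refine Finset.sum_congr rfl fun p _ => Finset.sum_congr rfl fun q _ => ?_
      have : (v + t • w) q - (v + t • w) p = (v q - v p) + t • (w q - w p) := by
        simp only [Pi.add_apply, Pi.smul_apply, smul_sub]; abel
      rw [this, norm_add_sq_real, norm_smul, inner_smul_right, mul_pow, Real.norm_eq_abs, sq_abs]
      ring
    rw [← h]; positivity
  -- The quadratic t ↦ |v + t w|_*² is nonnegative, so its discriminant is nonpositive.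
  have hd := discrim_le_zero hb
  rw [discrim] at hd
  have h2 : (aB Ω 𝒯 ν v w / ν) ^ 2 ≤ (starNorm Ω 𝒯 v * starNorm Ω 𝒯 w) ^ 2 := by nlinarith
  have h3 := abs_le_of_sq_le_sq h2 (mul_nonneg (starNorm_nonneg v) (starNorm_nonneg w))
  have h4 : |aB Ω 𝒯 ν v w / ν| ≤ starNorm Ω 𝒯 v * starNorm Ω 𝒯 w := h3
  rw [abs_div, abs_of_pos hν, div_le_iff₀ hν] at h4
  linarith

end Basic

/-! ### Minkowski's relation for polytopes: area-weighted normals sum to zero -/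

section Polytope

variable {V : Type*} [NormedAddCommGroup V] [InnerProductSpace ℝ V]

/-- The polytope (with the origin in its interior) with the polar vertices `s`. -/
def polarSet (s : Finset V) : Set V := {x | ∀ a ∈ s, inner ℝ a x ≤ 1}

/-- The facet of the polytope with outer normal `a`. -/
def polarFacet (s : Finset V) (a : V) : Set V := polarSet s ∩ {x | inner ℝ a x = 1}

/-- The pyramid over a facet with apex at the origin. -/
def polarCone (s : Finset V) (a : V) : Set V :=
  {x | inner ℝ a x ≤ 1 ∧ ∀ b ∈ s, inner ℝ b x ≤ inner ℝ a x}

theorem polarCone_subset (s : Finset V) (a : V) : polarCone s a ⊆ polarSet s :=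
  fun _ hx b hb => (hx.2 b hb).trans hx.1

theorem isClosed_polarCone (s : Finset V) (a : V) : IsClosed (polarCone s a) := by
  have : polarCone s a = {x | inner ℝ a x ≤ 1} ∩ ⋂ b ∈ s, {x | inner ℝ b x ≤ inner ℝ a x} := by
    ext x; simp [polarCone]
  rw [this]
  refine (isClosed_le (by fun_prop) (by fun_prop)).inter ?_
  exact isClosed_biInter fun b _ => isClosed_le (by fun_prop) (by fun_prop)

theorem isClosed_polarSet (s : Finset V) : IsClosed (polarSet s) := by
  have : polarSet s = ⋂ b ∈ s, {x | inner ℝ b x ≤ 1} := by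
    ext x; simp [polarSet]
  rw [this]
  exact isClosed_biInter fun b _ => isClosed_le (by fun_prop) (by fun_prop)

/-- A nonzero x of this kind would span a ray contained in the bounded polytope. -/
theorem eq_zero_of_inner_nonpos {s : Finset V} (hb : Bornology.IsBounded (polarSet s)) {x : V}
    (hx : ∀ a ∈ s, inner ℝ a x ≤ 0) : x = 0 := by
  by_contra hne
  obtain ⟨R, hR⟩ := hb.exists_norm_le
  have hpos : 0 < ‖x‖ := norm_pos_iff.2 hne
  have h1 := hR (((|R| + 1) / ‖x‖) • x) (by
    intro a ha
    rw [inner_smul_right]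
    have := hx a ha
    have h3 : 0 ≤ (|R| + 1) / ‖x‖ := by positivity
    nlinarith)
  rw [norm_smul, Real.norm_of_nonneg (by positivity), div_mul_cancel₀ _ hpos.ne'] at h1
  linarith [le_abs_self R]

variable [FiniteDimensional ℝ V] [MeasurableSpace V] [BorelSpace V]

theorem volume_hyperplane {a : V} (ha : a ≠ 0) (c : ℝ) :
    volume {x : V | inner ℝ a x = c} = 0 := by
  rcases Set.eq_empty_or_nonempty {x : V | inner ℝ a x = c} with h | ⟨x₀, hx₀⟩
  · rw [h, measure_empty]
  · have e : {x : V | inner ℝ a x = c} = (AffineSubspace.mk' x₀ (ℝ ∙ a)ᗮ : Set V) := by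
      ext x
      simp only [Set.mem_ofPred_eq] at hx₀
      simp only [Set.mem_ofPred_eq, SetLike.mem_coe, AffineSubspace.mem_mk', vsub_eq_sub,
        Submodule.mem_orthogonal_singleton_iff_inner_right, inner_sub_right, hx₀, sub_eq_zero]
    rw [e]
    apply Measure.addHaar_affineSubspace
    intro htop
    have h1 : x₀ + a ∈ AffineSubspace.mk' x₀ (ℝ ∙ a)ᗮ := by rw [htop]; trivial
    rw [AffineSubspace.mem_mk', vsub_eq_sub, add_sub_cancel_left,
      Submodule.mem_orthogonal_singleton_iff_inner_right] at h1
    exact ha (inner_self_eq_zero.1 h1)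

/-- The divergence theorem for the Lipschitz tent function over a polytope. -/
theorem sum_volume_polarCone_smul {s : Finset V} (hs : s.Nonempty)
    (hb : Bornology.IsBounded (polarSet s)) :
    ∑ a ∈ s, (volume (polarCone s a)).toReal • a = 0 := by
  -- f is the gauge-like maximum of the facet functionals and g = max(0, 1 - f) is the tent over the
  -- polytope. On the pyramid over the facet of a, the gradient of g is -a almost everywhere, so the
  -- vanishing of ∫∇g is the claim.
  set f : V → ℝ := fun x => s.sup' hs (fun a => inner ℝ a x) with hf
  have hfle : ∀ x, ∀ a ∈ s, inner ℝ a x ≤ f x := fun x a ha =>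
    Finset.le_sup' (fun a => inner ℝ a x) ha
  set C : NNReal := ∑ a ∈ s, ‖a‖₊ with hC
  have hfL : LipschitzWith C f := by
    apply LipschitzWith.of_le_add_mul
    intro x y
    apply Finset.sup'_le
    intro a ha
    have h1 : inner ℝ a x = inner ℝ a y + inner ℝ a (x - y) := by rw [inner_sub_right]; ring
    have h2 : inner ℝ a (x - y) ≤ ‖a‖ * ‖x - y‖ := real_inner_le_norm _ _
    have h3 : ‖a‖ ≤ (C : ℝ) := by
      rw [hC]; push_cast
      exact Finset.single_le_sum (f := fun a : V => ‖a‖) (fun _ _ => norm_nonneg _) ha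
    rw [h1, dist_eq_norm]
    have := hfle y a ha
    nlinarith [norm_nonneg (x - y)]
  set g : V → ℝ := fun x => max 0 (1 - f x) with hg
  have hgL : LipschitzWith C g := by
    have h1 : LipschitzWith C (fun x => 1 - f x) := by
      apply LipschitzWith.of_dist_le_mul
      intro x y
      have := hfL.dist_le_mul y x
      rw [Real.dist_eq] at this ⊢
      rw [dist_comm x y]
      convert this using 2
      ring
    exact h1.const_max 0
  have hgc : HasCompactSupport g := by
    apply HasCompactSupport.of_support_subset_isCompact
      (Metric.isCompact_of_isClosed_isBounded (isClosed_polarSet s) hb)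
    intro x hx a ha
    by_contra hlt
    apply hx
    simp only [hg]
    apply max_eq_left
    linarith [hfle x a ha, not_le.1 hlt]
  have hfc : Continuous f := hfL.continuous
  have key : ∀ v : V, ∑ a ∈ s, (volume (polarCone s a)).toReal * inner ℝ a v = 0 := by
    intro v
    -- Integration by parts against the constant 1. The direction is -v because the formula reverses
    -- the direction on the other factor.
    have h0 := LipschitzWith.integral_lineDeriv_mul_eq (μ := (volume : Measure V))
      (LipschitzWith.const (1 : ℝ)) hgL hgc (-v)
    simp only [neg_neg, mul_one] at h0
    have hz : ∀ x : V, lineDeriv ℝ (fun _ : V => (1 : ℝ)) x (-v) = 0 := fun x =>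
      ((hasFDerivAt_const (1 : ℝ) x).hasLineDerivAt (-v)).lineDeriv
    simp only [hz, zero_mul, integral_zero] at h0
    have hae : (fun x => lineDeriv ℝ g x v) =ᵐ[volume]
        fun x => ∑ a ∈ s, (polarCone s a).indicator (fun _ => - inner ℝ a v) x := by
      have hN1 : ∀ᵐ x : V, ∀ a ∈ s, inner ℝ a x ≠ (1 : ℝ) := by
        rw [Finset.eventually_all]
        intro a ha
        rcases eq_or_ne a 0 with rfl | hne
        · filter_upwards with x
          simp
        · exact measure_eq_zero_iff_ae_notMem.1 (volume_hyperplane hne 1)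
      -- Off finitely many hyperplanes the maximum f is attained by a single a and is different from
      -- 1, so g is affine near x.
      have hN2 : ∀ᵐ x : V, ∀ a ∈ s, ∀ b ∈ s, a ≠ b → inner ℝ a x ≠ inner ℝ b x := by
        rw [Finset.eventually_all]
        intro a ha
        rw [Finset.eventually_all]
        intro b hb
        by_cases hab : a = b
        · filter_upwards with x using fun h => absurd hab h
        · filter_upwards [measure_eq_zero_iff_ae_notMem.1
            (volume_hyperplane (sub_ne_zero.2 hab) 0)] with x hx _ he
          apply hx
          simp only [inner_sub_left, he, sub_self]
      filter_upwards [hN1, hN2] with x h1 h2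
      obtain ⟨a, ha, hmax⟩ := Finset.exists_mem_eq_sup' hs (fun a => inner ℝ a x)
      have hfa : f x = inner ℝ a x := hmax
      rcases lt_or_gt_of_ne (h1 a ha) with hlt | hgt
      · have hlt' : ∀ b ∈ s, b ≠ a → inner ℝ b x < inner ℝ a x := fun b hb hba =>
          lt_of_le_of_ne (hfa ▸ hfle x b hb) (h2 b hb a ha hba)
        have hev : g =ᶠ[nhds x] fun y => 1 - inner ℝ a y := by
          have e1 : ∀ᶠ y in nhds x, inner ℝ a y < (1 : ℝ) :=
            (isOpen_lt (by fun_prop) (by fun_prop)).mem_nhds hlt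
          have e2 : ∀ᶠ y in nhds x, ∀ b ∈ s, b ≠ a → inner ℝ b y < inner ℝ a y := by
            rw [Finset.eventually_all]
            intro b hb
            by_cases hba : b = a
            · filter_upwards with y using fun h => absurd hba h
            · have : ∀ᶠ y in nhds x, inner ℝ b y < inner ℝ a y :=
                (isOpen_lt (by fun_prop) (by fun_prop)).mem_nhds (hlt' b hb hba)
              filter_upwards [this] with y hy _ using hy
          filter_upwards [e1, e2] with y hy1 hy2
          have : f y = inner ℝ a y := by
            apply le_antisymm _ (hfle y a ha)
            apply Finset.sup'_le
            intro b hb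
            by_cases hba : b = a
            · rw [hba]
            · exact (hy2 b hb hba).le
          simp only [hg, this]
          exact max_eq_right (by linarith)
        have hd : HasFDerivAt (fun y : V => 1 - inner ℝ a y) (-(innerSL ℝ a)) x := by
          have := ((innerSL ℝ a).hasFDerivAt (x := x)).const_sub 1
          simpa using this
        have := ((hd.congr_of_eventuallyEq hev).hasLineDerivAt v).lineDeriv
        rw [this, Finset.sum_eq_single_of_mem a ha]
        · rw [Set.indicator_of_mem]
          · simp
          · exact ⟨hlt.le, fun b hb => hfa ▸ hfle x b hb⟩
        · intro b hb hba
          rw [Set.indicator_of_notMem]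
          intro hmem
          exact absurd (hmem.2 a ha) (not_le.2 (hlt' b hb hba))
      · have hev : g =ᶠ[nhds x] fun y => 0 := by
          have e1 : ∀ᶠ y in nhds x, 1 < f y :=
            (isOpen_lt (by fun_prop) hfc).mem_nhds (hgt.trans_eq hfa.symm)
          filter_upwards [e1] with y hy
          exact max_eq_left (by linarith)
        have hd : HasFDerivAt g (0 : V →L[ℝ] ℝ) x :=
          (hasFDerivAt_const (0 : ℝ) x).congr_of_eventuallyEq hev
        rw [(hd.hasLineDerivAt v).lineDeriv, Finset.sum_eq_zero]
        · simp
        · intro b hb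
          rw [Set.indicator_of_notMem]
          intro hmem
          linarith [hmem.1, hmem.2 a ha]
    rw [integral_congr_ae hae, integral_finsetSum] at h0
    · have : ∀ a ∈ s, ∫ x, (polarCone s a).indicator (fun _ => - inner ℝ a v) x =
          - ((volume (polarCone s a)).toReal * inner ℝ a v) := by
        intro a _
        rw [integral_indicator_const _ (isClosed_polarCone s a).measurableSet]
        simp [Measure.real]
      rw [Finset.sum_congr rfl this, Finset.sum_neg_distrib, zero_eq_neg] at h0
      exact h0
    · intro a _
      refine (integrable_indicator_iff (isClosed_polarCone s a).measurableSet).2 ?_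
      refine integrableOn_const ?_
      exact ((hb.subset (polarCone_subset s a)).measure_lt_top).ne
  apply ext_inner_right ℝ
  intro v
  rw [sum_inner, inner_zero_left, ← key v]
  refine Finset.sum_congr rfl fun a _ => ?_
  rw [real_inner_smul_left]

/-- Volume of a pyramid. -/
theorem volume_polarCone {s : Finset V} (hb : Bornology.IsBounded (polarSet s)) {a : V}
    (ha0 : a ≠ 0) (hdim : 0 < Module.finrank ℝ V) :
    (volume (polarCone s a)).toReal = ‖a‖⁻¹ * (Module.finrank ℝ V : ℝ)⁻¹ *
      (Measure.euclideanHausdorffMeasure (Module.finrank ℝ V - 1) (polarFacet s a)).toReal := by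
  set n := Module.finrank ℝ V with hn
  -- v is the foot of the perpendicular from the apex to the facet hyperplane. Its length 1/‖a‖ is
  -- the height of the pyramid, and the slice through t • v is the level set ⟪a, x⟫ = t.
  set v : V := (‖a‖ ^ 2)⁻¹ • a with hv
  have hna : 0 < ‖a‖ := norm_pos_iff.2 ha0
  have hv0 : v ≠ 0 := smul_ne_zero (by positivity) ha0
  have hav : inner ℝ a v = (1 : ℝ) := by
    rw [hv, inner_smul_right, real_inner_self_eq_norm_sq]; field_simp
  have hvn : ‖v‖ = ‖a‖⁻¹ := by
    rw [hv, norm_smul, norm_inv, norm_pow, norm_norm]; field_simp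
  have hslice : ∀ t : ℝ, (AffineSubspace.mk' (t • v +ᵥ (0 : V)) (ℝ ∙ v)ᗮ : Set V)
      = {x | inner ℝ a x = t} := by
    intro t
    ext x
    simp only [SetLike.mem_coe, AffineSubspace.mem_mk', vsub_eq_sub, vadd_eq_add, add_zero,
      Submodule.mem_orthogonal_singleton_iff_inner_right, Set.mem_ofPred_eq]
    have : inner ℝ v (x - t • v) = (‖a‖ ^ 2)⁻¹ * (inner ℝ a x - t) := by
      nth_rewrite 1 [hv]
      rw [real_inner_smul_left, inner_sub_right, inner_smul_right, hav, mul_one]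
    rw [this, mul_eq_zero, sub_eq_zero]
    simp [hna.ne']
  set F := polarFacet s a with hF
  set μ : Measure V := Measure.euclideanHausdorffMeasure (n - 1) with hμ
  have hmeas_slice : ∀ t : ℝ, t ≠ 0 → μ (polarCone s a ∩ {x | inner ℝ a x = t}) =
      (Set.Ioc (0 : ℝ) 1).indicator (fun t => ENNReal.ofReal (t ^ (n - 1)) * μ F) t := by
    intro t ht
    by_cases hmem : t ∈ Set.Ioc (0 : ℝ) 1
    · rw [Set.indicator_of_mem hmem]
      -- The slice at height t is the facet scaled by t, with measure t^(n-1) times that of the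
      -- facet. Integration over (0,1] yields the factor 1/n.
      have : polarCone s a ∩ {x | inner ℝ a x = t} = AffineMap.homothety (0 : V) t '' F := by
        ext x
        constructor
        · rintro ⟨⟨h1, h2⟩, h3⟩
          simp only [Set.mem_ofPred_eq] at h3
          refine ⟨t⁻¹ • x, ⟨fun b hb => ?_, ?_⟩, ?_⟩
          · rw [inner_smul_right, inv_mul_le_iff₀ hmem.1, mul_one, ← h3]
            exact h2 b hb
          · simp only [Set.mem_ofPred_eq, inner_smul_right, h3]
            exact inv_mul_cancel₀ ht
          · simp [AffineMap.homothety_apply, smul_smul, mul_inv_cancel₀ ht]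
        · rintro ⟨y, ⟨h1, h2⟩, rfl⟩
          simp only [Set.mem_ofPred_eq] at h2
          simp only [AffineMap.homothety_apply, vsub_eq_sub, sub_zero, vadd_eq_add, add_zero]
          refine ⟨⟨?_, fun b hb => ?_⟩, ?_⟩
          · rw [inner_smul_right, h2, mul_one]; exact hmem.2
          · rw [inner_smul_right, inner_smul_right, h2]
            exact mul_le_mul_of_nonneg_left (h1 b hb) hmem.1.le
          · simp only [Set.mem_ofPred_eq, inner_smul_right, h2, mul_one]
      rw [this, euclideanHausdorffMeasure_homothety_image _ _ ht, ENNReal.smul_def, smul_eq_mul]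
      congr 1
      rw [ENNReal.ofReal, Real.toNNReal_pow hmem.1.le]
      congr 2
      apply NNReal.eq
      simp [abs_of_pos hmem.1, hmem.1.le]
    · rw [Set.indicator_of_notMem hmem]
      have : polarCone s a ∩ {x | inner ℝ a x = t} = ∅ := by
        rw [Set.eq_empty_iff_forall_notMem]
        rintro x ⟨⟨h1, h2⟩, h3⟩
        simp only [Set.mem_ofPred_eq] at h3
        apply hmem
        refine ⟨?_, h3 ▸ h1⟩
        by_contra hle
        have hx0 := eq_zero_of_inner_nonpos hb (x := x) fun b hb =>
          (h2 b hb).trans (h3 ▸ not_lt.1 hle)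
        rw [hx0, inner_zero_right] at h3
        exact ht h3.symm
      rw [this, measure_empty]
  have hvol : volume (polarCone s a) = ‖v‖ₑ * (ENNReal.ofReal ((n : ℝ)⁻¹) * μ F) := by
    rw [← InnerProductSpace.euclideanHausdorffMeasure_eq_volume,
      EuclideanGeometry.euclideanHausdorffMeasure_eq_lintegral (0 : V) hv0
        (isClosed_polarCone s a).measurableSet]
    simp only [hslice]
    congr 1
    have hae : (fun t : ℝ => μ (polarCone s a ∩ {x | inner ℝ a x = t})) =ᵐ[volume]
        (Set.Ioc (0 : ℝ) 1).indicator (fun t => ENNReal.ofReal (t ^ (n - 1)) * μ F) := by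
      filter_upwards [measure_eq_zero_iff_ae_notMem.1 (Real.volume_singleton (a := 0))]
        with t ht using hmeas_slice t ht
    rw [lintegral_congr_ae hae, lintegral_indicator measurableSet_Ioc,
      lintegral_mul_const _ (by fun_prop)]
    congr 1
    rw [← ofReal_integral_eq_lintegral_ofReal]
    · rw [← intervalIntegral.integral_of_le zero_le_one, integral_pow]
      congr 1
      have : ((n - 1 : ℕ) : ℝ) + 1 = n := by
        rw [Nat.cast_sub hdim]; simp
      rw [this]
      simp [Nat.sub_add_cancel hdim, hdim.ne']
    · exact (Continuous.integrableOn_Icc (by fun_prop)).mono_set Set.Ioc_subset_Icc_self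
    · filter_upwards [ae_restrict_mem measurableSet_Ioc] with t ht
      exact pow_nonneg ht.1.le _
  rw [hvol, ENNReal.toReal_mul, ENNReal.toReal_mul, toReal_enorm, hvn,
    ENNReal.toReal_ofReal (by positivity), mul_assoc]

/-- Minkowski's relation: the area-weighted outer normals of a polytope sum up to zero. -/
theorem sum_area_smul_normal {s : Finset V} (hs : s.Nonempty) (h0 : (0 : V) ∉ s)
    (hb : Bornology.IsBounded (polarSet s)) (hdim : 0 < Module.finrank ℝ V) :
    ∑ a ∈ s, (Measure.euclideanHausdorffMeasure (Module.finrank ℝ V - 1)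
      (polarFacet s a)).toReal • (‖a‖⁻¹ • a) = 0 := by
  have h := sum_volume_polarCone_smul hs hb
  have e : ∀ a ∈ s, (volume (polarCone s a)).toReal • a = (Module.finrank ℝ V : ℝ)⁻¹ •
      ((Measure.euclideanHausdorffMeasure (Module.finrank ℝ V - 1)
        (polarFacet s a)).toReal • (‖a‖⁻¹ • a)) := by
    intro a ha
    rw [volume_polarCone hb (fun e => h0 (e ▸ ha)) hdim, smul_smul, smul_smul]
    congr 1
    ring
  rw [Finset.sum_congr rfl e, ← Finset.smul_sum, smul_eq_zero] at h
  refine h.resolve_left ?_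
  have : (Module.finrank ℝ V : ℝ) ≠ 0 := Nat.cast_ne_zero.2 hdim.ne'
  exact inv_ne_zero this

end Polytope

/-! ### Minkowski's relation applied to interior boxes -/

section Minkowski

variable {d : ℕ} {Ω : Set (E d)} {𝒯 : Finset (Finset (E d))}

theorem dist_le_dist_iff_inner (p q x : E d) :
    dist x p ≤ dist x q ↔ 2 * inner ℝ (q - p) (x - p) ≤ ‖q - p‖ ^ 2 := by
  rw [dist_eq_norm, dist_eq_norm, ← sq_le_sq₀ (norm_nonneg _) (norm_nonneg _)]
  have : x - q = (x - p) - (q - p) := by abel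
  rw [this, norm_sub_sq_real (x - p) (q - p), real_inner_comm (q - p) (x - p)]
  constructor <;> intro h <;> linarith

theorem face_eq_of_interior (hin : InteriorBoxesInside Ω 𝒯) {p : E d} (hp : p ∈ verts 𝒯)
    (hpΩ : p ∈ Ω) (q : E d) : face Ω 𝒯 p q = voronoiCell 𝒯 p ∩ voronoiCell 𝒯 q := by
  have h := hin p hp hpΩ
  ext x
  simp only [face, box, Set.mem_inter_iff]
  constructor
  · rintro ⟨⟨h1, _⟩, h2, _⟩
    exact ⟨h1, h2⟩
  · rintro ⟨h1, h2⟩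
    exact ⟨⟨h1, h h1⟩, h2, h h1⟩

/-- The vector `a` such that `{x | ⟪a, x - p⟫ = 1}` is the bisector of `p` and `q`. -/
def polarVertex (p q : E d) : E d := (2 * (‖q - p‖ ^ 2)⁻¹) • (q - p)

theorem inner_polarVertex_le_one_iff {p q : E d} (h : q ≠ p) (x : E d) :
    inner ℝ (polarVertex p q) (x - p) ≤ (1 : ℝ) ↔ dist x p ≤ dist x q := by
  have hpos : 0 < ‖q - p‖ := norm_pos_iff.2 (sub_ne_zero.2 h)
  rw [dist_le_dist_iff_inner, polarVertex, real_inner_smul_left, mul_comm 2, mul_assoc,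
    inv_mul_le_iff₀ (by positivity), mul_one]

theorem norm_polarVertex {p q : E d} (h : q ≠ p) : ‖polarVertex p q‖ = 2 * ‖q - p‖⁻¹ := by
  have hpos : 0 < ‖q - p‖ := norm_pos_iff.2 (sub_ne_zero.2 h)
  rw [polarVertex, norm_smul, Real.norm_of_nonneg (by positivity)]
  field_simp

theorem polarVertex_ne_zero {p q : E d} (h : q ≠ p) : polarVertex p q ≠ 0 := by
  have hpos : 0 < ‖q - p‖ := norm_pos_iff.2 (sub_ne_zero.2 h)
  rw [← norm_pos_iff, norm_polarVertex h]
  positivity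

theorem normalized_polarVertex {p q : E d} (h : q ≠ p) :
    ‖polarVertex p q‖⁻¹ • polarVertex p q = normal p q := by
  have hpos : 0 < ‖q - p‖ := norm_pos_iff.2 (sub_ne_zero.2 h)
  rw [norm_polarVertex h, polarVertex, normal, smul_smul, dist_comm, dist_eq_norm]
  congr 1
  field_simp

theorem polarVertex_injOn (p : E d) : Set.InjOn (polarVertex p) {q | q ≠ p} := by
  intro q hq r hr h
  have h1 := norm_polarVertex hq
  rw [h, norm_polarVertex hr] at h1
  have h2 : ‖r - p‖ = ‖q - p‖ := by simpa using h1
  rw [polarVertex, polarVertex, h2] at h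
  have hpos : 0 < ‖q - p‖ := norm_pos_iff.2 (sub_ne_zero.2 hq)
  have := smul_right_injective (E d) (by positivity : 2 * (‖q - p‖ ^ 2)⁻¹ ≠ 0) h
  exact sub_left_injective this

/-- Minkowski's relation for the box of an interior vertex. -/
theorem sum_area_normal_eq_zero (hd : 0 < d) (hbdd : Bornology.IsBounded Ω)
    (hin : InteriorBoxesInside Ω 𝒯) {p : E d} (hp : p ∈ verts 𝒯) (hpΩ : p ∈ Ω) :
    ∑ q ∈ nbrs Ω 𝒯 p, area Ω 𝒯 p q • normal p q = 0 := by
  classical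
  -- Translated by -p, the Voronoi cell is the polytope with these polar vertices. It is bounded
  -- because interior cells stay in the closure of Ω.
  set s := ((verts 𝒯).erase p).image (polarVertex p) with hs
  have hmem : ∀ x : E d, x ∈ polarSet s ↔ x + p ∈ voronoiCell 𝒯 p := by
    intro x
    simp only [polarSet, voronoiCell, hs, Finset.mem_image, Finset.mem_erase, Set.mem_ofPred_eq]
    constructor
    · intro h q hq
      by_cases hqp : q = p
      · rw [hqp]
      · have := h _ ⟨q, ⟨hqp, hq⟩, rfl⟩
        rw [← inner_polarVertex_le_one_iff hqp, add_sub_cancel_right]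
        exact this
    · rintro h _ ⟨q, ⟨hqp, hq⟩, rfl⟩
      have := (inner_polarVertex_le_one_iff hqp (x + p)).2 (h q hq)
      rwa [add_sub_cancel_right] at this
  have himg : polarSet s = (fun x => x + -p) '' voronoiCell 𝒯 p := by
    ext x
    rw [hmem]
    constructor
    · intro h
      exact ⟨_, h, by simp⟩
    · rintro ⟨y, hy, rfl⟩
      simpa using hy
  have hb : Bornology.IsBounded (polarSet s) := by
    rw [himg]
    have h1 : Bornology.IsBounded (voronoiCell 𝒯 p) := hbdd.closure.subset (hin p hp hpΩ)
    exact (LipschitzWith.id.add (LipschitzWith.const (-p))).isBounded_image h1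
  have hfacet : ∀ q ∈ (verts 𝒯).erase p,
      Measure.euclideanHausdorffMeasure (d - 1) (polarFacet s (polarVertex p q)) =
        Measure.euclideanHausdorffMeasure (d - 1) (face Ω 𝒯 p q) := by
    intro q hq
    obtain ⟨hqp, hq⟩ := Finset.mem_erase.1 hq
    have : face Ω 𝒯 p q = (fun x => x + p) '' polarFacet s (polarVertex p q) := by
      rw [face_eq_of_interior hin hp hpΩ]
      ext x
      constructor
      · rintro ⟨h1, h2⟩
        refine ⟨x - p, ⟨(hmem _).2 (by simpa using h1), ?_⟩, by simp⟩
        have e1 := (inner_polarVertex_le_one_iff hqp x).2 (h1 q hq)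
        refine le_antisymm e1 ?_
        have e2 := (dist_le_dist_iff_inner q p x).1 (h2 p hp)
        have hpos : 0 < ‖q - p‖ := norm_pos_iff.2 (sub_ne_zero.2 hqp)
        rw [polarVertex, real_inner_smul_left, mul_comm 2, mul_assoc, le_inv_mul_iff₀
          (by positivity), mul_one]
        rw [norm_sub_rev p q] at e2
        have e3 : inner ℝ (p - q) (x - q) = ‖q - p‖ ^ 2 - inner ℝ (q - p) (x - p) := by
          have : x - q = (x - p) - (q - p) := by abel
          rw [this, inner_sub_right, ← neg_sub q p, inner_neg_left, inner_neg_left,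
            real_inner_self_eq_norm_sq]
          ring
        linarith
      · rintro ⟨y, ⟨h1, h2⟩, rfl⟩
        have h3 := (hmem y).1 h1
        refine ⟨h3, fun r hr => ?_⟩
        have h4 : dist (y + p) q ≤ dist (y + p) p := by
          rw [dist_le_dist_iff_inner]
          have hpos : 0 < ‖q - p‖ := norm_pos_iff.2 (sub_ne_zero.2 hqp)
          simp only [Set.mem_ofPred_eq] at h2
          rw [polarVertex, real_inner_smul_left, mul_comm 2, mul_assoc, inv_mul_eq_iff_eq_mul₀
            (by positivity), mul_one] at h2
          have : y + p - q = y - (q - p) := by abel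
          rw [this, inner_sub_right, ← neg_sub q p, inner_neg_left, inner_neg_left,
            real_inner_self_eq_norm_sq, norm_neg]
          linarith
        exact h4.trans (h3 r hr)
    rw [this]
    exact ((isometry_add_right p).euclideanHausdorffMeasure_image _).symm
  rcases ((verts 𝒯).erase p).eq_empty_or_nonempty with he | hne
  · apply Finset.sum_eq_zero
    intro q hq
    have h1 := mem_nbrs.1 hq
    have h2 : q ∈ (verts 𝒯).erase p := Finset.mem_erase.2 ⟨h1.2.1, h1.1⟩
    rw [he] at h2
    simp at h2
  · have h0 : (0 : E d) ∉ s := by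
      intro h
      obtain ⟨q, hq, h⟩ := Finset.mem_image.1 h
      exact polarVertex_ne_zero (Finset.mem_erase.1 hq).1 h
    have hrank : Module.finrank ℝ (E d) = d := by simp
    have key := sum_area_smul_normal (hne.image _) h0 hb (by rw [hrank]; exact hd)
    rw [hrank, Finset.sum_image] at key
    · have e : ∀ q ∈ (verts 𝒯).erase p,
          (Measure.euclideanHausdorffMeasure (d - 1) (polarFacet s (polarVertex p q))).toReal •
            (‖polarVertex p q‖⁻¹ • polarVertex p q) = area Ω 𝒯 p q • normal p q := by
        intro q hq
        rw [hfacet q hq, normalized_polarVertex (Finset.mem_erase.1 hq).1]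
        rfl
      rw [Finset.sum_congr rfl e] at key
      rw [← key]
      apply Finset.sum_subset
      · intro q hq
        have h1 := mem_nbrs.1 hq
        exact Finset.mem_erase.2 ⟨h1.2.1, h1.1⟩
      -- Facets of zero area are absent from `nbrs` and contribute nothing to the relation.
      · intro q hq hn
        have h1 := Finset.mem_erase.1 hq
        have h2 : area Ω 𝒯 p q = 0 := by
          by_contra h
          exact hn (mem_nbrs.2 ⟨h1.2, h1.1, lt_of_le_of_ne (area_nonneg p q) (Ne.symm h)⟩)
        rw [h2, zero_smul]
    · intro q hq r hr h
      exact polarVertex_injOn p (Finset.mem_erase.1 hq).1 (Finset.mem_erase.1 hr).1 h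

end Minkowski

/-! ### Skew-adjointness of discrete gradient and divergence -/

section Forms

variable {d : ℕ} {Ω : Set (E d)} {𝒯 : Finset (Finset (E d))}

/-- The discrete gradient and divergence are skew-adjoint on fields vanishing on the boundary. -/
theorem bB_eq_neg_cB (hd : 0 < d) (hopen : IsOpen Ω) (hbdd : Bornology.IsBounded Ω)
    (h𝒯 : IsTriangulation Ω 𝒯) (hin : InteriorBoxesInside Ω 𝒯) {v : E d → E d}
    (hv : ∀ x ∈ frontier Ω, v x = 0) (r : E d → ℝ) : bB Ω 𝒯 v r = - cB Ω 𝒯 v r := by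
  have hvert : ∀ p ∈ verts 𝒯, v p = 0 ∨ (p ∈ Ω ∧ bdryNormal Ω 𝒯 p = 0) := by
    intro p hp
    by_cases hf : p ∈ frontier Ω
    · exact Or.inl (hv p hf)
    · refine Or.inr ⟨?_, by simp [bdryNormal, hf]⟩
      have := h𝒯.vert_mem_closure hp
      rw [hopen.frontier_eq] at hf
      by_contra hn
      exact hf ⟨this, hn⟩
  have hb : bB Ω 𝒯 v r = ∑ p ∈ verts 𝒯, ∑ q ∈ nbrs Ω 𝒯 p,
      (1 / 2) * (area Ω 𝒯 p q * (r q - r p) * inner ℝ (normal p q) (v p)) := by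
    refine Finset.sum_congr rfl fun p hp => ?_
    rcases hvert p hp with h0 | ⟨hpΩ, hm⟩
    · simp [h0]
    · rw [gaussGreen, hm, smul_zero, add_zero, sum_inner]
      -- Subtracting r(p) times Minkowski's relation turns the averages (r(p) + r(q))/2 into
      -- half-differences (r(q) - r(p))/2.
      have hmk : ∑ q ∈ nbrs Ω 𝒯 p, r p * (area Ω 𝒯 p q * inner ℝ (normal p q) (v p)) = 0 := by
        rw [← Finset.mul_sum]
        have := congrArg (fun z => inner ℝ z (v p)) (sum_area_normal_eq_zero hd hbdd hin hp hpΩ)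
        simp only [sum_inner, real_inner_smul_left, inner_zero_left] at this
        rw [this, mul_zero]
      rw [← sub_zero (∑ q ∈ nbrs Ω 𝒯 p, _), ← hmk, ← Finset.sum_sub_distrib]
      refine Finset.sum_congr rfl fun q hq => ?_
      rw [real_inner_smul_left, weight_eq (mem_nbrs.1 hq).2.1]
      ring
  have hc : cB Ω 𝒯 v r = ∑ p ∈ verts 𝒯, ∑ q ∈ nbrs Ω 𝒯 p,
      ((1 / 2) * (area Ω 𝒯 p q * r p * inner ℝ (normal p q) (v p)) +
        (1 / 2) * (area Ω 𝒯 p q * r p * inner ℝ (normal p q) (v q))) := by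
    refine Finset.sum_congr rfl fun p hp => ?_
    have hz : inner ℝ (v p) (bdryNormal Ω 𝒯 p) = (0 : ℝ) := by
      rcases hvert p hp with h0 | ⟨_, hm⟩
      · rw [h0, inner_zero_left]
      · rw [hm, inner_zero_right]
    rw [hz, add_zero, Finset.sum_mul]
    refine Finset.sum_congr rfl fun q hq => ?_
    rw [weight_eq (mem_nbrs.1 hq).2.1, inner_add_left, real_inner_smul_left, real_inner_smul_left,
      real_inner_comm (normal p q) (v p), real_inner_comm (normal p q) (v q)]
    ring
  -- Exchanging p and q reverses the normal, which moves the neighbour's velocity onto the pressure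
  -- difference.
  have hswap : ∑ p ∈ verts 𝒯, ∑ q ∈ nbrs Ω 𝒯 p,
      (1 / 2) * (area Ω 𝒯 p q * r p * inner ℝ (normal p q) (v q)) =
      ∑ p ∈ verts 𝒯, ∑ q ∈ nbrs Ω 𝒯 p,
        - ((1 / 2) * (area Ω 𝒯 p q * r q * inner ℝ (normal p q) (v p))) := by
    rw [sum_nbrs_comm]
    refine Finset.sum_congr rfl fun p _ => Finset.sum_congr rfl fun q _ => ?_
    rw [area_comm q p, normal_comm q p, inner_neg_left]
    ring
  simp only [Finset.sum_add_distrib] at hc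
  rw [hswap] at hc
  rw [hb, hc]
  simp only [← Finset.sum_add_distrib, ← Finset.sum_neg_distrib]
  refine Finset.sum_congr rfl fun p _ => Finset.sum_congr rfl fun q _ => ?_
  ring

theorem bB_congr {v w : E d → E d} (h : ∀ p ∈ verts 𝒯, v p = w p) (r : E d → ℝ) :
    bB Ω 𝒯 v r = bB Ω 𝒯 w r :=
  Finset.sum_congr rfl fun p hp => by rw [h p hp]

theorem cB_congr (v : E d → E d) {r s : E d → ℝ} (h : ∀ p ∈ verts 𝒯, r p = s p) :
    cB Ω 𝒯 v r = cB Ω 𝒯 v s :=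
  Finset.sum_congr rfl fun p hp => by rw [h p hp]

theorem aB_congr (ν : ℝ) (v : E d → E d) {w z : E d → E d} (h : ∀ p ∈ verts 𝒯, w p = z p) :
    aB Ω 𝒯 ν v w = aB Ω 𝒯 ν v z := by
  unfold aB
  congr 1
  exact Finset.sum_congr rfl fun p hp => by rw [h p hp]

end Forms

/-! ### Connecting nearby Voronoi cells through nondegenerate faces -/

section Connectivity

variable {d : ℕ} {𝒯 : Finset (Finset (E d))}

/-- A segment can be moved slightly so as to avoid a set of vanishing `(d-1)`-dimensional measure. -/
theorem exists_shift_segment_disjoint {N : Set (E d)}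
    (hN : Measure.euclideanHausdorffMeasure (d - 1) N = 0) {p q : E d} (hpq : p ≠ q) {ρ : ℝ}
    (hρ : 0 < ρ) : ∃ z : E d, ‖z‖ < ρ ∧ Disjoint (segment ℝ (p + z) (q + z)) N := by
  set K : Submodule ℝ (E d) := (ℝ ∙ (q - p))ᗮ with hK
  set P := K.orthogonalProjectionOnto with hP
  have hrank : Module.finrank ℝ K = d - 1 := by
    have h1 := (ℝ ∙ (q - p)).finrank_add_finrank_orthogonal
    rw [finrank_span_singleton (sub_ne_zero.2 hpq.symm), finrank_euclideanSpace_fin] at h1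
    rw [hK]; omega
  -- Projection along q - p sends the whole segment to one point and does not increase Hausdorff
  -- measure. The image of N is thus null in a (d-1)-dimensional space, and every ball there
  -- contains a point outside it.
  have hnull : Measure.euclideanHausdorffMeasure (d - 1) (P '' N) = 0 := by
    rw [Measure.euclideanHausdorffMeasure_def, Measure.smul_apply, smul_eq_zero] at hN ⊢
    right
    have h1 := hN.resolve_left
      (Measure.addHaarScalarFactor_volume_hausdorffMeasure_ne_zero (d - 1))
    exact le_antisymm ((hausdorffMeasure_orthogonalProjectionOnto_le K _ N
      (Nat.cast_nonneg _)).trans h1.le) (zero_le)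
  have hball : Measure.euclideanHausdorffMeasure (d - 1) (Metric.ball (P p) ρ) ≠ 0 := by
    rw [← hrank]
    exact (Metric.measure_ball_pos _ _ hρ).ne'
  obtain ⟨y, hy, hyN⟩ : ∃ y ∈ Metric.ball (P p) ρ, y ∉ P '' N := by
    by_contra! h
    exact hball (measure_mono_null h hnull)
  refine ⟨((y - P p : K) : E d), ?_, ?_⟩
  · have h1 : ‖y - P p‖ < ρ := by rw [← dist_eq_norm]; exact hy
    exact h1
  · rw [Set.disjoint_left]
    intro x hx hxN
    apply hyN
    refine ⟨x, hxN, ?_⟩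
    rw [segment_eq_image'] at hx
    obtain ⟨t, _, rfl⟩ := hx
    have h1 : P (q - p) = 0 := by
      rw [hP, Submodule.orthogonalProjectionOnto_eq_zero_iff, hK,
        Submodule.orthogonal_orthogonal]
      exact Submodule.mem_span_singleton_self _
    have h2 : (q + ((y - P p : K) : E d)) - (p + ((y - P p : K) : E d)) = q - p := by abel
    rw [h2, map_add, map_add, map_smul, h1, smul_zero, add_zero, hP,
      Submodule.orthogonalProjectionOnto_mem_subspace_eq_self]
    abel

theorem isClosed_voronoiCell (p : E d) : IsClosed (voronoiCell 𝒯 p) := by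
  have : voronoiCell 𝒯 p = ⋂ q ∈ verts 𝒯, {x | dist x p ≤ dist x q} := by
    ext x; simp [voronoiCell]
  rw [this]
  exact isClosed_biInter fun q _ => isClosed_le (by fun_prop) (by fun_prop)

theorem eventually_dist_lt (p : E d) :
    ∀ᶠ x in nhds p, ∀ q ∈ verts 𝒯, q ≠ p → dist x p < dist x q := by
  rw [Finset.eventually_all]
  intro q _
  by_cases hqp : q = p
  · filter_upwards with x using fun h => absurd hqp h
  · have : ∀ᶠ x in nhds p, dist x p < dist x q :=
      (isOpen_lt (by fun_prop) (by fun_prop)).mem_nhds (by simpa using Ne.symm hqp)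
    filter_upwards [this] with x hx _ using hx

theorem eventually_mem_voronoiCell (p : E d) : ∀ᶠ x in nhds p, x ∈ voronoiCell 𝒯 p := by
  filter_upwards [eventually_dist_lt (𝒯 := 𝒯) p] with x hx q hq
  by_cases hqp : q = p
  · rw [hqp]
  · exact (hx q hq hqp).le

/-- The graph of the Voronoi cells with a common face of positive area, for the centres in a
given set. -/
def voronoiGraph (𝒯 : Finset (Finset (E d))) (S : Finset (E d)) : SimpleGraph S where
  Adj k l := k ≠ l ∧ Measure.euclideanHausdorffMeasure (d - 1)
    (voronoiCell 𝒯 (k : E d) ∩ voronoiCell 𝒯 (l : E d)) ≠ 0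
  symm := ⟨fun k l h => ⟨h.1.symm, by rw [Set.inter_comm]; exact h.2⟩⟩
  loopless := ⟨fun _ h => h.1 rfl⟩

open Classical in
/-- The vertices at distance less than `R` from `x`. -/
def vertsNear (𝒯 : Finset (Finset (E d))) (x : E d) (R : ℝ) : Finset (E d) :=
  (verts 𝒯).filter fun k => dist k x < R

theorem mem_vertsNear {x k : E d} {R : ℝ} :
    k ∈ vertsNear 𝒯 x R ↔ k ∈ verts 𝒯 ∧ dist k x < R := by
  simp [vertsNear]

/-- The Voronoi cells near a vertex are connected to each other through faces. -/
theorem voronoiGraph_reachable {p q : E d} (hp : p ∈ verts 𝒯) (hq : q ∈ verts 𝒯) {R : ℝ}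
    (hR : dist q p < R) (hp' : p ∈ vertsNear 𝒯 p (2 * R)) (hq' : q ∈ vertsNear 𝒯 p (2 * R)) :
    (voronoiGraph 𝒯 (vertsNear 𝒯 p (2 * R))).Reachable ⟨p, hp'⟩ ⟨q, hq'⟩ := by
  set S := vertsNear 𝒯 p (2 * R) with hS
  set G := voronoiGraph 𝒯 S with hG
  by_contra hnr
  have hpq : p ≠ q := by
    rintro rfl
    exact hnr (SimpleGraph.Reachable.refl _)
  set C₁ : Set (E d) := ⋃ k ∈ {k : S | G.Reachable ⟨p, hp'⟩ k}, voronoiCell 𝒯 (k : E d) with hC₁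
  set C₂ : Set (E d) := ⋃ k ∈ {k : S | ¬ G.Reachable ⟨p, hp'⟩ k}, voronoiCell 𝒯 (k : E d) with hC₂
  have hc₁ : IsClosed C₁ :=
    (Set.toFinite _).isClosed_biUnion fun k _ => isClosed_voronoiCell _
  have hc₂ : IsClosed C₂ :=
    (Set.toFinite _).isClosed_biUnion fun k _ => isClosed_voronoiCell _
  -- The vertex k nearest to a point x of the ball satisfies d(k,p) ≤ 2 d(x,p) < 2R. This is why the
  -- graph uses centres within 2R.
  have hcover : Metric.ball p R ⊆ C₁ ∪ C₂ := by
    intro x hx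
    obtain ⟨k, hk, hmin⟩ := (verts 𝒯).exists_min_image (fun k => dist x k) ⟨p, hp⟩
    have hkS : k ∈ S := by
      rw [hS, mem_vertsNear]
      refine ⟨hk, ?_⟩
      have h1 := dist_triangle k x p
      have h2 := hmin p hp
      rw [Metric.mem_ball] at hx
      rw [dist_comm k x] at h1
      linarith
    by_cases hr : G.Reachable ⟨p, hp'⟩ ⟨k, hkS⟩
    · exact Or.inl (Set.mem_biUnion (x := (⟨k, hkS⟩ : S)) hr hmin)
    · exact Or.inr (Set.mem_biUnion (x := (⟨k, hkS⟩ : S)) hr hmin)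
  -- A cell reachable from p and an unreachable one are not adjacent, so their intersection has zero
  -- (d-1)-measure.
  have hnull : Measure.euclideanHausdorffMeasure (d - 1) (C₁ ∩ C₂) = 0 := by
    have hsub : C₁ ∩ C₂ ⊆ ⋃ k ∈ {k : S | G.Reachable ⟨p, hp'⟩ k},
        ⋃ l ∈ {k : S | ¬ G.Reachable ⟨p, hp'⟩ k},
          voronoiCell 𝒯 (k : E d) ∩ voronoiCell 𝒯 (l : E d) := by
      rintro x ⟨h1, h2⟩
      obtain ⟨k, hk, hxk⟩ := Set.mem_iUnion₂.1 h1
      obtain ⟨l, hl, hxl⟩ := Set.mem_iUnion₂.1 h2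
      exact Set.mem_biUnion hk (Set.mem_biUnion hl ⟨hxk, hxl⟩)
    refine measure_mono_null hsub ?_
    rw [measure_biUnion_null_iff (Set.to_countable _)]
    intro k hk
    rw [measure_biUnion_null_iff (Set.to_countable _)]
    intro l hl
    by_contra hne
    have hadj : G.Adj k l := ⟨fun e => hl (e ▸ hk), hne⟩
    exact hl (SimpleGraph.Reachable.trans hk hadj.reachable)
  have hp₀ : 0 < R := dist_nonneg.trans_lt hR
  obtain ⟨ρ₁, hρ₁, hb₁⟩ := Metric.eventually_nhds_iff.1
    ((eventually_mem_voronoiCell (𝒯 := 𝒯) p).and (Metric.ball_mem_nhds p hp₀))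
  obtain ⟨ρ₂, hρ₂, hb₂⟩ := Metric.eventually_nhds_iff.1
    ((eventually_mem_voronoiCell (𝒯 := 𝒯) q).and (Metric.isOpen_ball.mem_nhds
      (Metric.mem_ball.2 hR)))
  -- The shift is small enough that the ends remain in the cells of p and q and inside the ball. The
  -- shifted segment is connected, is covered by both closed families and meets each of them, yet
  -- avoids their intersection.
  obtain ⟨z, hz, hdis⟩ := exists_shift_segment_disjoint hnull hpq (lt_min hρ₁ hρ₂)
  have h1 := hb₁ (y := p + z) (by simpa using hz.trans_le (min_le_left _ _))
  have h2 := hb₂ (y := q + z) (by simpa using hz.trans_le (min_le_right _ _))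
  have hseg : segment ℝ (p + z) (q + z) ⊆ C₁ ∪ C₂ :=
    ((convex_ball p R).segment_subset h1.2 h2.2).trans hcover
  obtain ⟨x, hx, hx'⟩ := isPreconnected_closed_iff.1 (convex_segment (p + z) (q + z)).isPreconnected
    C₁ C₂ hc₁ hc₂ hseg
    ⟨p + z, left_mem_segment ℝ _ _, Set.mem_biUnion (x := (⟨p, hp'⟩ : S))
      (SimpleGraph.Reachable.refl _) h1.1⟩
    ⟨q + z, right_mem_segment ℝ _ _, Set.mem_biUnion (x := (⟨q, hq'⟩ : S)) hnr h2.1⟩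
  exact Set.disjoint_left.1 hdis hx hx'

theorem walk_norm_sub_le {α M : Type*} [SeminormedAddCommGroup M] {G : SimpleGraph α} (w : α → M)
    {B : ℝ} (hB : ∀ k l, G.Adj k l → ‖w k - w l‖ ≤ B) {p q : α} (W : G.Walk p q) :
    ‖w p - w q‖ ≤ W.length * B := by
  induction W with
  | nil => simp
  | cons h W ih =>
    rw [SimpleGraph.Walk.length_cons]
    push_cast
    have := norm_sub_le_norm_sub_add_norm_sub (w _) (w _) (w _) |>.trans (add_le_add (hB _ _ h) ih)
    linarith

/-- Differences of nodal values are bounded by the largest jump over the faces nearby. -/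
theorem norm_sub_le_of_jumps {M : Type*} [SeminormedAddCommGroup M] {p q : E d}
    (hp : p ∈ verts 𝒯) (hq : q ∈ verts 𝒯) {R : ℝ} (hR : dist q p < R) (w : E d → M) {B : ℝ}
    (hB0 : 0 ≤ B)
    (hB : ∀ k ∈ vertsNear 𝒯 p (2 * R), ∀ l ∈ vertsNear 𝒯 p (2 * R), k ≠ l →
      Measure.euclideanHausdorffMeasure (d - 1) (voronoiCell 𝒯 k ∩ voronoiCell 𝒯 l) ≠ 0 →
      ‖w k - w l‖ ≤ B) :
    ‖w p - w q‖ ≤ (vertsNear 𝒯 p (2 * R)).card * B := by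
  classical
  have hp₀ : 0 < R := dist_nonneg.trans_lt hR
  have hp' : p ∈ vertsNear 𝒯 p (2 * R) := mem_vertsNear.2 ⟨hp, by rw [dist_self]; linarith⟩
  have hq' : q ∈ vertsNear 𝒯 p (2 * R) := mem_vertsNear.2 ⟨hq, by linarith⟩
  obtain ⟨W⟩ := voronoiGraph_reachable hp hq hR hp' hq'
  have h1 := walk_norm_sub_le (G := voronoiGraph 𝒯 (vertsNear 𝒯 p (2 * R)))
    (fun k => w (k : E d)) (B := B)
    (fun k l h => hB k k.2 l l.2 (fun e => h.1 (Subtype.ext e)) h.2) W.toPath.1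
  refine h1.trans (mul_le_mul_of_nonneg_right ?_ hB0)
  -- A path repeats no vertex, so its length is less than the number of nearby centres.
  have h2 := W.toPath.2.length_lt
  rw [Fintype.card_coe] at h2
  exact_mod_cast h2.le

end Connectivity

/-! ### Counting nearby elements and bounding gradients elementwise -/

section MeshGeometry

variable {d : ℕ} {Ω : Set (E d)} {𝒯 : Finset (Finset (E d))}

theorem elemSize_le_meshSize {T : Finset (E d)} (hT : T ∈ 𝒯) : elemSize T ≤ meshSize 𝒯 :=
  le_csSup (𝒯.finite_toSet.image _).bddAbove ⟨T, hT, rfl⟩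

theorem dist_le_elemSize {T : Finset (E d)} {p q : E d} (hp : p ∈ simplex T)
    (hq : q ∈ simplex T) : dist p q ≤ elemSize T :=
  Metric.dist_le_diam_of_mem (isBounded_simplex T) hp hq

theorem IsTriangulation.elemSize_pos (h : IsTriangulation Ω 𝒯) (hd : 0 < d) {T : Finset (E d)}
    (hT : T ∈ 𝒯) : 0 < elemSize T := by
  obtain ⟨p, hp, q, hq, hpq⟩ := Finset.one_lt_card.1 (by rw [h.card_eq T hT]; omega)
  exact (dist_pos.2 hpq).trans_le
    (dist_le_elemSize (subset_simplex T hp) (subset_simplex T hq))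

theorem IsTriangulation.nonempty_of_mem (h : IsTriangulation Ω 𝒯) {T : Finset (E d)}
    (hT : T ∈ 𝒯) : T.Nonempty := by
  rw [← Finset.card_pos, h.card_eq T hT]; omega

/-- Different elements overlap in a null set only. -/
theorem IsTriangulation.aedisjoint (h : IsTriangulation Ω 𝒯) {S T : Finset (E d)} (hS : S ∈ 𝒯)
    (hT : T ∈ 𝒯) (hST : S ≠ T) : AEDisjoint volume (simplex S) (simplex T) := by
  classical
  unfold AEDisjoint
  rw [h.conforming S hS T hT, ← Finset.coe_inter]
  rcases (S ∩ T).eq_empty_or_nonempty with he | hne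
  · rw [he]; simp
  -- Distinct elements share at most d vertices, so their intersection spans a proper affine
  -- subspace.
  have hcard : (S ∩ T).card < d + 1 := by
    rw [← h.card_eq S hS]
    apply Finset.card_lt_card
    refine ⟨Finset.inter_subset_left, fun hsub => hST ?_⟩
    apply Finset.eq_of_subset_of_card_le (fun x hx => (Finset.mem_inter.1 (hsub hx)).2)
    rw [h.card_eq S hS, h.card_eq T hT]
  refine measure_mono_null (convexHull_subset_affineSpan _) ?_
  apply Measure.addHaar_affineSubspace
  intro htop
  obtain ⟨n, hn⟩ : ∃ n, (S ∩ T).card = n + 1 :=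
    ⟨(S ∩ T).card - 1, by have := hne.card_pos; omega⟩
  have h1 := finrank_vectorSpan_image_finset_le ℝ (id : E d → E d) (S ∩ T) hn
  rw [Finset.image_id, ← direction_affineSpan, htop, AffineSubspace.direction_top, finrank_top,
    finrank_euclideanSpace_fin] at h1
  omega

open Classical in
/-- The elements with a vertex at distance less than `R` from `x`. -/
def elemsNear (𝒯 : Finset (Finset (E d))) (x : E d) (R : ℝ) : Finset (Finset (E d)) :=
  𝒯.filter fun T => ∃ k ∈ T, dist k x < R

theorem mem_elemsNear {x : E d} {R : ℝ} {T : Finset (E d)} :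
    T ∈ elemsNear 𝒯 x R ↔ T ∈ 𝒯 ∧ ∃ k ∈ T, dist k x < R := by
  simp [elemsNear]

theorem card_vertsNear_le (h : IsTriangulation Ω 𝒯) (x : E d) (R : ℝ) :
    (vertsNear 𝒯 x R).card ≤ (elemsNear 𝒯 x R).card * (d + 1) := by
  classical
  refine le_trans (Finset.card_le_card (t := (elemsNear 𝒯 x R).biUnion id) ?_)
    (Finset.card_biUnion_le_card_mul _ _ _ fun T hT =>
      (h.card_eq T (mem_elemsNear.1 hT).1).le)
  intro k hk
  obtain ⟨hk, hkx⟩ := mem_vertsNear.1 hk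
  obtain ⟨T, hT, hkT⟩ := mem_verts.1 hk
  exact Finset.mem_biUnion.2 ⟨T, mem_elemsNear.2 ⟨hT, k, hkT, hkx⟩, hkT⟩

/-- In a regular mesh only a bounded number of elements lie near a given point. -/
theorem card_elemsNear_le (hd : 0 < d) (h : IsTriangulation Ω 𝒯) {σ δ κ : ℝ} (hσ : 0 < σ)
    (hδ : 0 < δ) (hreg : MeshRegular Ω 𝒯 σ δ κ) (x : E d) :
    ((elemsNear 𝒯 x (4 * meshSize 𝒯)).card : ℝ) ≤ (5 * σ / δ) ^ d := by
  rcases (elemsNear 𝒯 x (4 * meshSize 𝒯)).eq_empty_or_nonempty with he | ⟨T₀, hT₀⟩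
  · rw [he]; simp; positivity
  have hh : 0 < meshSize 𝒯 :=
    (h.elemSize_pos hd (mem_elemsNear.1 hT₀).1).trans_le (elemSize_le_meshSize (mem_elemsNear.1 hT₀).1)
  set H := meshSize 𝒯 with hH
  set A := elemsNear 𝒯 x (4 * H) with hA
  have hA𝒯 : ∀ T ∈ A, T ∈ 𝒯 := fun T hT => (mem_elemsNear.1 hT).1
  choose! y hy using hreg.shape
  set r := δ * H / σ with hr
  have hrpos : 0 < r := by positivity
  have hball : ∀ T ∈ A, Metric.closedBall (y T) r ⊆ simplex T := fun T hT =>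
    (Metric.closedBall_subset_closedBall
      (div_le_div_of_nonneg_right (hreg.quasiUniform T (hA𝒯 T hT)) hσ.le)).trans
      (hy T (hA𝒯 T hT))
  -- Radius 4H for the nearby vertex plus one diameter H gives 5H. The inscribed balls of radius
  -- δH/σ overlap only in null sets, and comparison of volumes bounds their number.
  have hsub : (⋃ T ∈ A, Metric.closedBall (y T) r) ⊆ Metric.closedBall x (5 * H) := by
    intro z hz
    obtain ⟨T, hT, hzT⟩ := Set.mem_iUnion₂.1 hz
    obtain ⟨hT𝒯, k, hk, hkx⟩ := mem_elemsNear.1 hT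
    have h1 := (dist_le_elemSize (hball T hT hzT) (subset_simplex T hk)).trans
      (elemSize_le_meshSize hT𝒯)
    rw [Metric.mem_closedBall]
    have := dist_triangle z k x
    linarith
  have hmeas := measure_mono (μ := (volume : Measure (E d))) hsub
  rw [measure_biUnion_finset₀ (fun S hS T hT hST => ((h.aedisjoint (hA𝒯 S hS) (hA𝒯 T hT) hST).mono
      (hball S hS) (hball T hT))) (fun T _ => measurableSet_closedBall.nullMeasurableSet)] at hmeas
  simp only [Measure.addHaar_closedBall (volume : Measure (E d)) _ hrpos.le,
    Measure.addHaar_closedBall (volume : Measure (E d)) _ (by positivity : 0 ≤ 5 * H),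
    Finset.sum_const, finrank_euclideanSpace_fin, nsmul_eq_mul, ← mul_assoc] at hmeas
  rw [ENNReal.mul_le_mul_iff_left (Metric.measure_ball_pos _ _ one_pos).ne'
    (measure_ball_lt_top).ne, ← ENNReal.ofReal_natCast, ← ENNReal.ofReal_mul (by positivity),
    ENNReal.ofReal_le_ofReal_iff (by positivity)] at hmeas
  have e : (5 * σ / δ) ^ d = (5 * H) ^ d / r ^ d := by
    rw [← div_pow, hr]; congr 1; field_simp
  rw [e, le_div_iff₀ (by positivity)]
  exact hmeas

/-- Gradient of an affine function on a simplex that contains a ball. -/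
theorem norm_linear_le {T : Finset (E d)} (φ : E d →ᵃ[ℝ] ℝ) {B r : ℝ} {x : E d} (hr : 0 < r)
    (hball : Metric.closedBall x r ⊆ simplex T) (hB : ∀ p ∈ T, ∀ q ∈ T, φ p - φ q ≤ B) :
    ‖LinearMap.toContinuousLinearMap φ.linear‖ ≤ B / r := by
  have h1 : ∀ q ∈ T, ∀ y ∈ simplex T, φ y - φ q ≤ B := by
    intro q hq y hy
    have hc : Convex ℝ (φ ⁻¹' Set.Iic (B + φ q)) := (convex_Iic _).affine_preimage φ
    have := convexHull_min (fun p hp => by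
      simp only [Set.mem_preimage, Set.mem_Iic]; linarith [hB p hp q hq]) hc hy
    simp only [Set.mem_preimage, Set.mem_Iic] at this
    linarith
  have h2 : ∀ y ∈ simplex T, ∀ z ∈ simplex T, φ y - φ z ≤ B := by
    intro y hy z hz
    have hc : Convex ℝ (φ ⁻¹' Set.Ici (φ y - B)) := (convex_Ici _).affine_preimage φ
    have := convexHull_min (fun p hp => by
      simp only [Set.mem_preimage, Set.mem_Ici]; linarith [h1 p hp y hy]) hc hz
    simp only [Set.mem_preimage, Set.mem_Ici] at this
    linarith
  have hx : x ∈ simplex T := hball (Metric.mem_closedBall_self hr.le)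
  have hB0 : 0 ≤ B := by have := h2 x hx x hx; linarith
  -- The slope in a unit direction e is read off between x and x + r • e, where the oscillation of φ
  -- is bounded by that over the vertices.
  have h3 : ∀ e : E d, ‖e‖ = 1 → φ.linear e ≤ B / r := by
    intro e he
    rw [le_div_iff₀ hr]
    have hm : x + r • e ∈ simplex T := hball (by
      rw [Metric.mem_closedBall, dist_eq_norm, add_sub_cancel_left, norm_smul, he,
        Real.norm_of_nonneg hr.le, mul_one])
    have h4 := h2 _ hm x hx
    have h5 : φ (x + r • e) = r * φ.linear e + φ x := by
      have := φ.map_vadd x (r • e)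
      rw [vadd_eq_add, vadd_eq_add, add_comm, map_smul, smul_eq_mul] at this
      exact this
    rw [h5] at h4
    linarith
  refine ContinuousLinearMap.opNorm_le_of_unit_norm (by positivity) fun e he => ?_
  rw [LinearMap.coe_toContinuousLinearMap', Real.norm_eq_abs, abs_le]
  refine ⟨?_, h3 e he⟩
  have := h3 (-e) (by rwa [norm_neg])
  rw [map_neg] at this
  linarith

theorem fderiv_eq_of_mem_interior {T : Finset (E d)} {v : E d → ℝ} {φ : E d →ᵃ[ℝ] ℝ}
    (hφ : Set.EqOn v φ (simplex T)) {x : E d} (hx : x ∈ interior (simplex T)) :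
    fderiv ℝ v x = LinearMap.toContinuousLinearMap φ.linear := by
  have hev : v =ᶠ[nhds x] φ := by
    filter_upwards [mem_interior_iff_mem_nhds.1 hx] with y hy using hφ hy
  rw [hev.fderiv_eq]
  have hdec : (φ : E d → ℝ) = fun y => LinearMap.toContinuousLinearMap φ.linear y + φ 0 := by
    ext y
    have := φ.map_vadd 0 y
    simpa using this
  rw [hdec]
  exact (((LinearMap.toContinuousLinearMap φ.linear).hasFDerivAt).add_const _).fderiv

theorem convex_simplex (T : Finset (E d)) : Convex ℝ (simplex T) := convex_convexHull ℝ _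

/-- Simplices are convex, hence have null frontiers; away from these, a piecewise affine function
has the gradient of its local affine piece. -/
theorem ae_mem_interior_simplex (h : IsTriangulation Ω 𝒯) :
    ∀ᵐ x ∂(volume.restrict (closure Ω)), ∃ T ∈ 𝒯, x ∈ interior (simplex T) := by
  have h1 : ∀ᵐ x : E d, ∀ T ∈ 𝒯, x ∉ frontier (simplex T) := by
    rw [Finset.eventually_all]
    intro T _
    exact measure_eq_zero_iff_ae_notMem.1 ((convex_simplex T).addHaar_frontier volume)
  filter_upwards [ae_restrict_of_ae h1, ae_restrict_mem isClosed_closure.measurableSet] with x hx hm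
  rw [← h.union_eq] at hm
  obtain ⟨T, hT, hxT⟩ := Set.mem_iUnion₂.1 hm
  refine ⟨T, hT, ?_⟩
  by_contra hn
  exact hx T hT ⟨subset_closure hxT, hn⟩

theorem volume_simplex_le (h : IsTriangulation Ω 𝒯) {T : Finset (E d)} (hT : T ∈ 𝒯) :
    (volume (simplex T)).toReal ≤
      elemSize T ^ d * (volume (Metric.ball (0 : E d) 1)).toReal := by
  obtain ⟨p, hp⟩ := h.nonempty_of_mem hT
  have hnn : 0 ≤ elemSize T := Metric.diam_nonneg
  have hsub : simplex T ⊆ Metric.closedBall p (elemSize T) := fun x hx =>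
    dist_le_elemSize hx (subset_simplex T hp)
  have := measureReal_mono (μ := (volume : Measure (E d))) hsub measure_closedBall_lt_top.ne
  rw [Measure.addHaar_real_closedBall _ _ hnn, finrank_euclideanSpace_fin] at this
  exact this

/-- The `H¹` seminorm is bounded by the jumps along the edges of the elements. -/
theorem h1Seminorm_sq_le_edges (hd : 0 < d) (h : IsTriangulation Ω 𝒯) {σ δ κ : ℝ}
    (hσ : 0 < σ) (hreg : MeshRegular Ω 𝒯 σ δ κ) {v : E d → E d} (hv : v ∈ VhVec Ω 𝒯) :
    h1Seminorm Ω v ^ 2 ≤ ∑ T ∈ 𝒯, elemSize T ^ d * (volume (Metric.ball (0 : E d) 1)).toReal *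
      ((σ / elemSize T) ^ 2 * ∑ p ∈ T, ∑ q ∈ T, ‖v p - v q‖ ^ 2) := by
  have hpos : ∀ T ∈ 𝒯, 0 < elemSize T := fun T hT => h.elemSize_pos hd hT
  have hk : ∀ k : Fin d, ∫ x in Ω, ‖fderiv ℝ (fun y => v y k) x‖ ^ 2 ≤
      ∑ T ∈ 𝒯, elemSize T ^ d * (volume (Metric.ball (0 : E d) 1)).toReal *
        ((σ / elemSize T) ^ 2 * ∑ p ∈ T, ∑ q ∈ T, (v p k - v q k) ^ 2) := by
    intro k
    obtain ⟨_, haff, _⟩ := hv k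
    -- The gradient on T is at most the largest vertex jump divided by the inscribed radius h_T/σ;
    -- the sum over all pairs of vertices dominates the square of that jump.
    set c : Finset (E d) → ℝ := fun T =>
      (σ / elemSize T) ^ 2 * ∑ p ∈ T, ∑ q ∈ T, (v p k - v q k) ^ 2 with hc
    have hc0 : ∀ T, 0 ≤ c T := fun T => mul_nonneg (sq_nonneg _)
      (Finset.sum_nonneg fun p _ => Finset.sum_nonneg fun q _ => sq_nonneg _)
    have hgrad : ∀ T ∈ 𝒯, ∀ x ∈ interior (simplex T),
        ‖fderiv ℝ (fun y => v y k) x‖ ^ 2 ≤ c T := by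
      intro T hT x hx
      obtain ⟨φ, hφ⟩ := haff T hT
      obtain ⟨z, hz⟩ := hreg.shape T hT
      have hs : ∀ p ∈ T, ∀ q ∈ T, φ p - φ q ≤
          √(∑ p ∈ T, ∑ q ∈ T, (v p k - v q k) ^ 2) := by
        intro p hp q hq
        apply Real.le_sqrt_of_sq_le
        rw [← hφ (subset_simplex T hp), ← hφ (subset_simplex T hq)]
        refine le_trans ?_ (Finset.single_le_sum (f := fun p => ∑ q ∈ T, (v p k - v q k) ^ 2)
          (fun p _ => Finset.sum_nonneg fun q _ => sq_nonneg _) hp)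
        exact Finset.single_le_sum (f := fun q => (v p k - v q k) ^ 2)
          (fun q _ => sq_nonneg _) hq
      have hTp := hpos T hT
      have := norm_linear_le φ (div_pos hTp hσ) hz hs
      rw [fderiv_eq_of_mem_interior hφ hx]
      refine (pow_le_pow_left₀ (norm_nonneg _) this 2).trans (le_of_eq ?_)
      rw [div_pow, Real.sq_sqrt (Finset.sum_nonneg fun p _ => Finset.sum_nonneg fun q _ =>
        sq_nonneg _), hc]
      field_simp
    have hI : ∀ T ∈ 𝒯, Integrable ((simplex T).indicator fun _ => c T) (volume : Measure (E d)) :=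
      fun T _ => (integrable_indicator_iff (isCompact_simplex T).isClosed.measurableSet).2
        (integrableOn_const (isCompact_simplex T).measure_lt_top.ne)
    have hae : ∀ᵐ x ∂(volume.restrict Ω), ‖fderiv ℝ (fun y => v y k) x‖ ^ 2 ≤
        ∑ T ∈ 𝒯, (simplex T).indicator (fun _ => c T) x := by
      filter_upwards [ae_restrict_of_ae_restrict_of_subset subset_closure
        (ae_mem_interior_simplex h)] with x hx
      obtain ⟨T, hT, hxT⟩ := hx
      refine (hgrad T hT x hxT).trans ?_
      refine le_trans (le_of_eq ?_) (Finset.single_le_sum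
        (f := fun T => (simplex T).indicator (fun _ => c T) x)
        (fun S _ => Set.indicator_nonneg (fun _ _ => hc0 S) x) hT)
      exact (Set.indicator_of_mem (interior_subset hxT) (fun _ => c T)).symm
    refine (integral_mono_of_nonneg (Filter.Eventually.of_forall fun x => by positivity)
      (integrable_finsetSum _ fun T hT => (hI T hT).integrableOn) hae).trans ?_
    rw [integral_finsetSum _ fun T hT => (hI T hT).integrableOn]
    apply Finset.sum_le_sum
    intro T hT
    refine (setIntegral_le_integral (hI T hT) (Filter.Eventually.of_forall fun x =>
      Set.indicator_nonneg (fun _ _ => hc0 T) x)).trans ?_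
    rw [integral_indicator_const _ (isCompact_simplex T).isClosed.measurableSet, smul_eq_mul]
    exact mul_le_mul_of_nonneg_right (volume_simplex_le h hT) (hc0 T)
  have hnn : 0 ≤ ∑ k : Fin d, ∫ x in Ω, ‖fderiv ℝ (fun y => v y k) x‖ ^ 2 :=
    Finset.sum_nonneg fun k _ => integral_nonneg fun x => by positivity
  rw [h1Seminorm, Real.sq_sqrt hnn]
  refine (Finset.sum_le_sum fun k _ => hk k).trans (le_of_eq ?_)
  rw [Finset.sum_comm]
  refine Finset.sum_congr rfl fun T _ => ?_
  rw [← Finset.mul_sum, ← Finset.mul_sum, Finset.sum_comm]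
  congr 2
  refine Finset.sum_congr rfl fun p _ => ?_
  rw [Finset.sum_comm]
  refine Finset.sum_congr rfl fun q _ => ?_
  rw [EuclideanSpace.norm_sq_eq]
  simp

end MeshGeometry

/-! ### The mesh-independent bound of the H¹ seminorm by |v|_* -/

section NormBound

variable {d : ℕ} {Ω : Set (E d)} {𝒯 : Finset (Finset (E d))}

/-- A face of bounded boxes has finite area. -/
theorem euclideanHausdorffMeasure_face_ne_top (hbdd : Bornology.IsBounded Ω) {p q : E d}
    (hp : p ∈ verts 𝒯) (hq : q ∈ verts 𝒯) (hpq : p ≠ q) :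
    Measure.euclideanHausdorffMeasure (d - 1) (face Ω 𝒯 p q) ≠ ⊤ := by
  rcases (face Ω 𝒯 p q).eq_empty_or_nonempty with he | ⟨x₀, hx₀⟩
  · rw [he]; simp
  set K : Submodule ℝ (E d) := (ℝ ∙ (q - p))ᗮ with hK
  have hrank : Module.finrank ℝ K = d - 1 := by
    have h1 := (ℝ ∙ (q - p)).finrank_add_finrank_orthogonal
    rw [finrank_span_singleton (sub_ne_zero.2 hpq.symm), finrank_euclideanSpace_fin] at h1
    rw [hK]; omega
  have hbis : ∀ x ∈ face Ω 𝒯 p q, x ∈ AffineSubspace.perpBisector p q := fun x hx =>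
    AffineSubspace.mem_perpBisector_iff_dist_eq.2 (le_antisymm (hx.1.1 q hq) (hx.2.1 p hp))
  have hsubΩ : face Ω 𝒯 p q ⊆ closure Ω := fun x hx => hx.1.2
  obtain ⟨R, hR⟩ := (hbdd.closure.subset hsubΩ).subset_closedBall x₀
  have hsub : face Ω 𝒯 p q ⊆ (fun y : K => (y : E d) + x₀) '' Metric.closedBall 0 R := by
    intro x hx
    have hmem : x - x₀ ∈ K := by
      have := AffineSubspace.vsub_mem_direction (hbis x hx) (hbis x₀ hx₀)
      rwa [AffineSubspace.direction_perpBisector] at this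
    refine ⟨⟨x - x₀, hmem⟩, ?_, by simp⟩
    have h1 := hR hx
    rw [Metric.mem_closedBall, dist_eq_norm] at h1
    simpa using h1
  have hiso : Isometry (fun y : K => (y : E d) + x₀) :=
    (isometry_add_right x₀).comp isometry_subtype_coe
  refine ((measure_mono hsub).trans_lt ?_).ne
  rw [hiso.euclideanHausdorffMeasure_image, ← hrank]
  exact (isCompact_closedBall _ _).measure_lt_top

/-- Finiteness of the face measure matters: `area` uses `toReal`, which would send an infinite
measure to 0. -/
theorem mem_nbrs_of_ne_zero (hbdd : Bornology.IsBounded Ω) (hin : InteriorBoxesInside Ω 𝒯)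
    {p q : E d} (hp : p ∈ verts 𝒯) (hq : q ∈ verts 𝒯) (hpq : p ≠ q) (hpΩ : p ∈ Ω)
    (hne : Measure.euclideanHausdorffMeasure (d - 1) (voronoiCell 𝒯 p ∩ voronoiCell 𝒯 q) ≠ 0) :
    q ∈ nbrs Ω 𝒯 p := by
  refine mem_nbrs.2 ⟨hq, hpq.symm, ?_⟩
  rw [← face_eq_of_interior hin hp hpΩ] at hne
  exact ENNReal.toReal_pos hne (euclideanHausdorffMeasure_face_ne_top hbdd hp hq hpq)

/-- The transmissibility of a face of an interior box is at least of the order of `h ^ (d - 2)`. -/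
theorem pow_meshSize_le (hd : 2 ≤ d) {σ δ κ : ℝ} (hδ : 0 < δ)
    (hκ : 0 < κ) (hh : 0 < meshSize 𝒯) (hreg : MeshRegular Ω 𝒯 σ δ κ) {p q : E d}
    (hp : p ∈ verts 𝒯) (hpΩ : p ∈ Ω) (hq : q ∈ nbrs Ω 𝒯 p) :
    meshSize 𝒯 ^ (d - 2) ≤ κ ^ 2 / δ ^ (d - 1) * (area Ω 𝒯 p q / dist p q) := by
  obtain ⟨T, hT, _, ⟨_, h1⟩, ⟨h2, _⟩⟩ := hreg.faces p hp hpΩ q hq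
  have hdist : 0 < dist p q := dist_pos.2 (mem_nbrs.1 hq).2.1.symm
  obtain ⟨n, rfl⟩ : ∃ n, d = n + 2 := ⟨d - 2, by omega⟩
  simp only [Nat.add_sub_cancel, show n + 2 - 1 = n + 1 from rfl] at h2 ⊢
  set H := meshSize 𝒯 with hH
  have h3 : dist p q ≤ κ * H :=
    h1.trans (mul_le_mul_of_nonneg_left (elemSize_le_meshSize hT) hκ.le)
  have h4 : κ⁻¹ * (δ * H) ^ (n + 1) ≤ area Ω 𝒯 p q :=
    (mul_le_mul_of_nonneg_left (pow_le_pow_left₀ (by positivity) (hreg.quasiUniform T hT) _)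
      (by positivity)).trans h2
  -- Area at least (δH)^(d-1)/κ over distance at most κH.
  have h5 : κ⁻¹ * (δ * H) ^ (n + 1) / (κ * H) ≤ area Ω 𝒯 p q / dist p q :=
    div_le_div₀ (area_nonneg p q) h4 hdist h3
  refine le_trans (le_of_eq ?_) (mul_le_mul_of_nonneg_left h5 (by positivity))
  rw [mul_pow]
  field_simp
  ring

theorem VhVec0.eq_zero_of_notMem (h : IsTriangulation Ω 𝒯) (hopen : IsOpen Ω)
    {v : E d → E d} (hv : v ∈ VhVec0 Ω 𝒯) {p : E d} (hp : p ∈ verts 𝒯) (hpΩ : p ∉ Ω) :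
    v p = 0 :=
  hv.2 p (by rw [hopen.frontier_eq]; exact ⟨h.vert_mem_closure hp, hpΩ⟩)

/-- The contribution of a box to (twice) the square of the seminorm `|v|_*`. -/
def localEnergy (Ω : Set (E d)) (𝒯 : Finset (Finset (E d))) (v : E d → E d) (p : E d) : ℝ :=
  ∑ q ∈ nbrs Ω 𝒯 p, area Ω 𝒯 p q / dist p q * ‖v q - v p‖ ^ 2

theorem localEnergy_nonneg (v : E d → E d) (p : E d) : 0 ≤ localEnergy Ω 𝒯 v p :=
  Finset.sum_nonneg fun q _ => mul_nonneg (div_nonneg (area_nonneg p q) dist_nonneg) (sq_nonneg _)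

theorem jump_le_localEnergy (hd : 2 ≤ d) {σ δ κ : ℝ} (hδ : 0 < δ)
    (hκ : 0 < κ) (hh : 0 < meshSize 𝒯) (hreg : MeshRegular Ω 𝒯 σ δ κ) {p q : E d}
    (hp : p ∈ verts 𝒯) (hpΩ : p ∈ Ω) (hq : q ∈ nbrs Ω 𝒯 p) (v : E d → E d) :
    meshSize 𝒯 ^ (d - 2) * ‖v q - v p‖ ^ 2 ≤
      κ ^ 2 / δ ^ (d - 1) * localEnergy Ω 𝒯 v p := by
  refine (mul_le_mul_of_nonneg_right (pow_meshSize_le hd hδ hκ hh hreg hp hpΩ hq)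
    (sq_nonneg _)).trans ?_
  rw [mul_assoc]
  refine mul_le_mul_of_nonneg_left ?_ (by positivity)
  exact Finset.single_le_sum (f := fun q => area Ω 𝒯 p q / dist p q * ‖v q - v p‖ ^ 2)
    (fun q _ => mul_nonneg (div_nonneg (area_nonneg p q) dist_nonneg) (sq_nonneg _)) hq

/-- Jumps along the edges of the elements are controlled by the jumps over the faces nearby. -/
theorem edge_jump_le (hd : 2 ≤ d) (hopen : IsOpen Ω) (hbdd : Bornology.IsBounded Ω)
    (h : IsTriangulation Ω 𝒯) (hin : InteriorBoxesInside Ω 𝒯) {σ δ κ : ℝ}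
    (hδ : 0 < δ) (hκ : 0 < κ) (hreg : MeshRegular Ω 𝒯 σ δ κ) {v : E d → E d}
    (hv : v ∈ VhVec0 Ω 𝒯) {T : Finset (E d)} (hT : T ∈ 𝒯) {p q : E d} (hp : p ∈ T)
    (hq : q ∈ T) :
    meshSize 𝒯 ^ (d - 2) * ‖v p - v q‖ ^ 2 ≤
      ((vertsNear 𝒯 p (4 * meshSize 𝒯)).card : ℝ) ^ 2 * (κ ^ 2 / δ ^ (d - 1) *
        ∑ k ∈ vertsNear 𝒯 p (4 * meshSize 𝒯), localEnergy Ω 𝒯 v k) := by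
  have hh : 0 < meshSize 𝒯 :=
    (h.elemSize_pos (by omega) hT).trans_le (elemSize_le_meshSize hT)
  set H := meshSize 𝒯 with hH
  set S := vertsNear 𝒯 p (4 * H) with hS
  set Q := κ ^ 2 / δ ^ (d - 1) * ∑ k ∈ S, localEnergy Ω 𝒯 v k with hQ
  have hQ0 : 0 ≤ Q := mul_nonneg (by positivity)
    (Finset.sum_nonneg fun k _ => localEnergy_nonneg v k)
  have hpv := mem_verts.2 ⟨T, hT, hp⟩
  have hqv := mem_verts.2 ⟨T, hT, hq⟩
  have hpow : 0 < H ^ (d - 2) := by positivity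
  have hdist : dist q p < 2 * H := by
    have := (dist_le_elemSize (subset_simplex T hq) (subset_simplex T hp)).trans
      (elemSize_le_meshSize hT)
    linarith
  have h22 : 2 * (2 * H) = 4 * H := by ring
  have hle : ∀ k ∈ S, κ ^ 2 / δ ^ (d - 1) * localEnergy Ω 𝒯 v k ≤ Q := fun k hk =>
    mul_le_mul_of_nonneg_left (Finset.single_le_sum (f := fun k => localEnergy Ω 𝒯 v k)
      (fun k _ => localEnergy_nonneg v k) hk) (by positivity)
  -- Regularity of faces is available only next to an interior vertex. If either of k, l is
  -- interior, its local energy bounds the jump; if neither is, both values vanish. The strict bound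
  -- d(q,p) < 2H leads to chains within 4H.
  have key := norm_sub_le_of_jumps hpv hqv hdist v (Real.sqrt_nonneg (Q / H ^ (d - 2))) (by
    rw [h22]
    intro k hk l hl hkl hne
    have hkv := (mem_vertsNear.1 hk).1
    have hlv := (mem_vertsNear.1 hl).1
    apply Real.le_sqrt_of_sq_le
    rw [le_div_iff₀' hpow]
    by_cases hkΩ : k ∈ Ω
    · rw [norm_sub_rev]
      exact (jump_le_localEnergy hd hδ hκ hh hreg hkv hkΩ
        (mem_nbrs_of_ne_zero hbdd hin hkv hlv hkl hkΩ hne) v).trans (hle k hk)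
    by_cases hlΩ : l ∈ Ω
    · rw [Set.inter_comm] at hne
      exact (jump_le_localEnergy hd hδ hκ hh hreg hlv hlΩ
        (mem_nbrs_of_ne_zero hbdd hin hlv hkv hkl.symm hlΩ hne) v).trans (hle l hl)
    · rw [VhVec0.eq_zero_of_notMem h hopen hv hkv hkΩ,
        VhVec0.eq_zero_of_notMem h hopen hv hlv hlΩ]
      simpa using hQ0)
  rw [h22] at key
  have key2 := pow_le_pow_left₀ (norm_nonneg _) key 2
  rw [mul_pow, Real.sq_sqrt (by positivity)] at key2
  calc H ^ (d - 2) * ‖v p - v q‖ ^ 2 ≤ H ^ (d - 2) * ((S.card : ℝ) ^ 2 * (Q / H ^ (d - 2))) :=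
        mul_le_mul_of_nonneg_left key2 hpow.le
    _ = (S.card : ℝ) ^ 2 * Q := by field_simp

/-- Double counting: if k is near a vertex of T, then T is near k. Each k is therefore counted for
at most N elements, and at most d+1 times in each. -/
theorem sum_near_le (h : IsTriangulation Ω 𝒯) {N R : ℝ}
    (hN : ∀ x, ((elemsNear 𝒯 x R).card : ℝ) ≤ N) {e : E d → ℝ} (he : ∀ k, 0 ≤ e k) :
    ∑ T ∈ 𝒯, ∑ p ∈ T, ∑ k ∈ vertsNear 𝒯 p R, e k ≤ N * (d + 1) * ∑ k ∈ verts 𝒯, e k := by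
  classical
  have h1 : ∀ T ∈ 𝒯, ∑ p ∈ T, ∑ k ∈ vertsNear 𝒯 p R, e k ≤
      ∑ k ∈ verts 𝒯, if T ∈ elemsNear 𝒯 k R then (d + 1) * e k else 0 := by
    intro T hT
    have h2 : ∀ p ∈ T, ∑ k ∈ vertsNear 𝒯 p R, e k ≤
        ∑ k ∈ verts 𝒯, if T ∈ elemsNear 𝒯 k R then e k else 0 := by
      intro p hp
      rw [vertsNear, Finset.sum_filter]
      apply Finset.sum_le_sum
      intro k hk
      by_cases hkp : dist k p < R
      · rw [if_pos hkp, if_pos (mem_elemsNear.2 ⟨hT, p, hp, by rwa [dist_comm]⟩)]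
      · rw [if_neg hkp]
        split_ifs
        · exact he k
        · exact le_rfl
    refine (Finset.sum_le_sum h2).trans (le_of_eq ?_)
    rw [Finset.sum_const, h.card_eq T hT, nsmul_eq_mul, Finset.mul_sum]
    refine Finset.sum_congr rfl fun k _ => ?_
    push_cast
    split_ifs <;> simp
  refine (Finset.sum_le_sum h1).trans ?_
  rw [Finset.sum_comm, Finset.mul_sum]
  apply Finset.sum_le_sum
  intro k _
  rw [← Finset.sum_filter, Finset.sum_const, nsmul_eq_mul, mul_assoc]
  refine mul_le_mul_of_nonneg_right ?_ (mul_nonneg (by positivity) (he k))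
  refine le_trans ?_ (hN k)
  exact_mod_cast Finset.card_le_card fun T hT => (Finset.mem_filter.1 hT).2

/-- On fields vanishing on the boundary the `H¹` seminorm is bounded by `|v|_*`, uniformly in the
triangulation. -/
theorem exists_h1Seminorm_le (hd : 2 ≤ d) (hopen : IsOpen Ω) (hbdd : Bornology.IsBounded Ω)
    {σ δ κ : ℝ} (hσ : 0 < σ) (hδ : 0 < δ) (hκ : 0 < κ) :
    ∃ C : ℝ, 0 < C ∧ ∀ 𝒯 : Finset (Finset (E d)), IsTriangulation Ω 𝒯 →
      InteriorBoxesInside Ω 𝒯 → MeshRegular Ω 𝒯 σ δ κ →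
      ∀ v ∈ VhVec0 Ω 𝒯, h1Seminorm Ω v ≤ C * starNorm Ω 𝒯 v := by
  set N : ℝ := (5 * σ / δ) ^ d with hN
  set ω : ℝ := (volume (Metric.ball (0 : E d) 1)).toReal with hω
  have hω0 : 0 ≤ ω := ENNReal.toReal_nonneg
  set K : ℝ := κ ^ 2 / δ ^ (d - 1) with hK
  -- The factors are: ωσ² from volume and gradient on an element, d+1 from the second endpoint of an
  -- edge, the squared chain length, K from the size of the faces, N(d+1) from double counting, and
  -- 2 because local energies count every face twice.
  set C2 : ℝ := ω * σ ^ 2 * ((d + 1) * ((N * (d + 1)) ^ 2 * (K * (N * (d + 1) * 2)))) with hC2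
  have hN0 : 0 ≤ N := by positivity
  have hK0 : 0 ≤ K := by positivity
  have hC20 : 0 ≤ C2 := by positivity
  refine ⟨√C2 + 1, by positivity, fun 𝒯 h hin hreg v hv => ?_⟩
  have hcardE : ∀ x, ((elemsNear 𝒯 x (4 * meshSize 𝒯)).card : ℝ) ≤ N :=
    card_elemsNear_le (by omega) h hσ hδ hreg
  have hcardV : ∀ x, ((vertsNear 𝒯 x (4 * meshSize 𝒯)).card : ℝ) ≤ N * (d + 1) := by
    intro x
    refine le_trans (b := ((elemsNear 𝒯 x (4 * meshSize 𝒯)).card : ℝ) * (d + 1)) ?_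
      (mul_le_mul_of_nonneg_right (hcardE x) (by positivity))
    exact_mod_cast card_vertsNear_le h x _
  have hmain : h1Seminorm Ω v ^ 2 ≤ C2 * starNorm Ω 𝒯 v ^ 2 := by
    refine (h1Seminorm_sq_le_edges (by omega) h hσ hreg hv.1).trans ?_
    have hT : ∀ T ∈ 𝒯, elemSize T ^ d * ω *
        ((σ / elemSize T) ^ 2 * ∑ p ∈ T, ∑ q ∈ T, ‖v p - v q‖ ^ 2) ≤
        ω * σ ^ 2 * ((d + 1) * ((N * (d + 1)) ^ 2 * (K *
          ∑ p ∈ T, ∑ k ∈ vertsNear 𝒯 p (4 * meshSize 𝒯), localEnergy Ω 𝒯 v k))) := by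
      intro T hT
      have hpos := h.elemSize_pos (by omega) hT
      -- Element volume h^d against squared gradient h^(-2) leaves h^(d-2), the scaling of |F|/d on
      -- a face.
      have e1 : elemSize T ^ d * ω *
          ((σ / elemSize T) ^ 2 * ∑ p ∈ T, ∑ q ∈ T, ‖v p - v q‖ ^ 2) =
          ω * σ ^ 2 * ∑ p ∈ T, ∑ q ∈ T, elemSize T ^ (d - 2) * ‖v p - v q‖ ^ 2 := by
        simp only [← Finset.mul_sum]
        obtain ⟨n, rfl⟩ : ∃ n, d = n + 2 := ⟨d - 2, by omega⟩
        simp only [Nat.add_sub_cancel]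
        field_simp
        ring
      rw [e1]
      refine mul_le_mul_of_nonneg_left ?_ (by positivity)
      have e2 : ∀ p ∈ T, ∑ q ∈ T, elemSize T ^ (d - 2) * ‖v p - v q‖ ^ 2 ≤
          (d + 1) * ((N * (d + 1)) ^ 2 * (K *
            ∑ k ∈ vertsNear 𝒯 p (4 * meshSize 𝒯), localEnergy Ω 𝒯 v k)) := by
        intro p hp
        have e3 : ∀ q ∈ T, elemSize T ^ (d - 2) * ‖v p - v q‖ ^ 2 ≤ (N * (d + 1)) ^ 2 * (K *
            ∑ k ∈ vertsNear 𝒯 p (4 * meshSize 𝒯), localEnergy Ω 𝒯 v k) := by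
          intro q hq
          refine (mul_le_mul_of_nonneg_right (pow_le_pow_left₀ hpos.le (elemSize_le_meshSize hT) _)
            (sq_nonneg _)).trans ?_
          refine (edge_jump_le hd hopen hbdd h hin hδ hκ hreg hv hT hp hq).trans ?_
          exact mul_le_mul_of_nonneg_right (pow_le_pow_left₀ (Nat.cast_nonneg _) (hcardV p) 2)
            (mul_nonneg hK0 (Finset.sum_nonneg fun k _ => localEnergy_nonneg v k))
        refine (Finset.sum_le_sum e3).trans (le_of_eq ?_)
        rw [Finset.sum_const, h.card_eq T hT, nsmul_eq_mul]
        push_cast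
        rfl
      refine (Finset.sum_le_sum e2).trans (le_of_eq ?_)
      simp only [← Finset.mul_sum]
    refine (Finset.sum_le_sum hT).trans ?_
    simp only [← Finset.mul_sum]
    have h1 := sum_near_le h hcardE (localEnergy_nonneg (Ω := Ω) (𝒯 := 𝒯) v)
    have h2 : ∑ k ∈ verts 𝒯, localEnergy Ω 𝒯 v k = 2 * starNorm Ω 𝒯 v ^ 2 := by
      rw [starNorm_sq]
      simp only [localEnergy]
      ring
    rw [h2] at h1
    calc _ ≤ ω * σ ^ 2 * ((d + 1) * ((N * (d + 1)) ^ 2 * (K *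
          (N * (d + 1) * (2 * starNorm Ω 𝒯 v ^ 2))))) := by gcongr
      _ = C2 * starNorm Ω 𝒯 v ^ 2 := by rw [hC2]; ring
  have h3 := starNorm_nonneg (Ω := Ω) (𝒯 := 𝒯) v
  have h4 : h1Seminorm Ω v ≤ √C2 * starNorm Ω 𝒯 v := by
    apply le_of_sq_le_sq _ (by positivity)
    rw [mul_pow, Real.sq_sqrt hC20]
    exact hmain
  linarith

end NormBound

/-! ### The forms as linear functionals of nodal values -/

section Residuals

variable {d : ℕ} {Ω : Set (E d)} {𝒯 : Finset (Finset (E d))}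

/-- The linear functional on nodal values with the coefficients `a` and `b`. -/
def nodalPairing (𝒯 : Finset (Finset (E d))) (a : E d → E d) (b : E d → ℝ) (v : E d → E d)
    (q : E d → ℝ) : ℝ :=
  ∑ p ∈ verts 𝒯, (inner ℝ (a p) (v p) + b p * q p)

/-- The coefficients of `C̃_B((u,r),·)` with respect to the velocity test function. -/
def momentumResidual (Ω : Set (E d)) (𝒯 : Finset (Finset (E d))) (ν : ℝ) (u : E d → E d)
    (r : E d → ℝ) (p : E d) : E d :=
  gaussGreen Ω 𝒯 r p - ∑ q ∈ nbrs Ω 𝒯 p, (ν * (area Ω 𝒯 p q / dist p q)) • (u q - u p)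

/-- The coefficients of `C̃_B((u,r),·)` with respect to the pressure test function. -/
def massResidual (Ω : Set (E d)) (𝒯 : Finset (Finset (E d))) (ν : ℝ) (u : E d → E d)
    (r : E d → ℝ) (p : E d) : ℝ :=
  inner ℝ (u p) (bdryNormal Ω 𝒯 p) + ∑ q ∈ nbrs Ω 𝒯 p,
    (area Ω 𝒯 p q * inner ℝ (weight p q • u p + (1 - weight p q) • u q) (normal p q) +
      area Ω 𝒯 p q *
        inner ℝ ((weight p q * (diagA Ω 𝒯 ν p)⁻¹) • gaussGreen Ω 𝒯 r p
          + ((1 - weight p q) * (diagA Ω 𝒯 ν q)⁻¹) • gaussGreen Ω 𝒯 r q) (normal p q) -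
      area Ω 𝒯 p q *
        (weight p q * boxVol Ω 𝒯 p * (diagA Ω 𝒯 ν p)⁻¹
          + (1 - weight p q) * boxVol Ω 𝒯 q * (diagA Ω 𝒯 ν q)⁻¹) *
        ((r q - r p) / dist p q))

/-- Reduces linearity and boundedness of the form in its test pair to those of a finite sum of nodal
values. -/
theorem CB_eq_nodalPairing (h : IsTriangulation Ω 𝒯) (ν : ℝ) (u : E d → E d) (r : E d → ℝ)
    (v : E d → E d) (q : E d → ℝ) :
    CB Ω 𝒯 ν u r (lump Ω 𝒯 v) (lump Ω 𝒯 q) =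
      nodalPairing 𝒯 (momentumResidual Ω 𝒯 ν u r) (massResidual Ω 𝒯 ν u r) v q := by
  unfold CB aB bB cB sB nodalPairing momentumResidual massResidual
  rw [← Finset.sum_neg_distrib, ← Finset.sum_sub_distrib]
  simp only [← Finset.sum_add_distrib]
  refine Finset.sum_congr rfl fun p hp => ?_
  rw [lump_vert h v hp, lump_vert h q hp, inner_sub_left, sum_inner, add_mul (inner ℝ (u p) _),
    Finset.sum_mul]
  simp only [real_inner_smul_left, sub_mul, add_mul, Finset.sum_sub_distrib,
    Finset.sum_add_distrib, Finset.sum_mul]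
  ring

theorem gaussGreen_add_smul (c : ℝ) (r s : E d → ℝ) (p : E d) :
    gaussGreen Ω 𝒯 (r + c • s) p = gaussGreen Ω 𝒯 r p + c • gaussGreen Ω 𝒯 s p := by
  unfold gaussGreen
  simp only [Pi.add_apply, Pi.smul_apply, smul_eq_mul, smul_add, Finset.smul_sum, smul_smul,
    add_smul]
  rw [add_add_add_comm, ← Finset.sum_add_distrib]
  congr 1
  refine Finset.sum_congr rfl fun q _ => ?_
  rw [← add_smul]
  congr 1
  ring

theorem momentumResidual_add_smul (ν c : ℝ) (u w : E d → E d) (r s : E d → ℝ) (p : E d) :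
    momentumResidual Ω 𝒯 ν (u + c • w) (r + c • s) p =
      momentumResidual Ω 𝒯 ν u r p + c • momentumResidual Ω 𝒯 ν w s p := by
  unfold momentumResidual
  rw [gaussGreen_add_smul, smul_sub, Finset.smul_sum, sub_add_sub_comm, ← Finset.sum_add_distrib]
  congr 1
  refine Finset.sum_congr rfl fun q _ => ?_
  simp only [Pi.add_apply, Pi.smul_apply]
  module

theorem massResidual_add_smul (ν c : ℝ) (u w : E d → E d) (r s : E d → ℝ) (p : E d) :
    massResidual Ω 𝒯 ν (u + c • w) (r + c • s) p =
      massResidual Ω 𝒯 ν u r p + c * massResidual Ω 𝒯 ν w s p := by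
  unfold massResidual
  rw [mul_add, Finset.mul_sum, add_add_add_comm, ← Finset.sum_add_distrib]
  congr 1
  · simp only [Pi.add_apply, Pi.smul_apply, inner_add_left, real_inner_smul_left]
  · refine Finset.sum_congr rfl fun q _ => ?_
    simp only [gaussGreen_add_smul, Pi.add_apply, Pi.smul_apply, inner_add_left,
      real_inner_smul_left, smul_eq_mul]
    ring

theorem CB_add_smul (h : IsTriangulation Ω 𝒯) (ν c : ℝ) (u w : E d → E d) (r s : E d → ℝ)
    (v : E d → E d) (q : E d → ℝ) :
    CB Ω 𝒯 ν (u + c • w) (r + c • s) (lump Ω 𝒯 v) (lump Ω 𝒯 q) =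
      CB Ω 𝒯 ν u r (lump Ω 𝒯 v) (lump Ω 𝒯 q) +
        c * CB Ω 𝒯 ν w s (lump Ω 𝒯 v) (lump Ω 𝒯 q) := by
  simp only [CB_eq_nodalPairing h, nodalPairing, Finset.mul_sum, ← Finset.sum_add_distrib]
  refine Finset.sum_congr rfl fun p _ => ?_
  rw [momentumResidual_add_smul, massResidual_add_smul, inner_add_left, real_inner_smul_left]
  ring

theorem CB_zero_left (h : IsTriangulation Ω 𝒯) (ν : ℝ) (v : E d → E d) (q : E d → ℝ) :
    CB Ω 𝒯 ν 0 0 (lump Ω 𝒯 v) (lump Ω 𝒯 q) = 0 := by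
  have := CB_add_smul h ν 1 0 0 0 0 v q
  simpa using this

theorem measurableSet_box (p : E d) : MeasurableSet (box Ω 𝒯 p) :=
  ((isClosed_voronoiCell p).inter isClosed_closure).measurableSet

theorem load_eq_nodalPairing (hbdd : Bornology.IsBounded Ω) {f : E d → E d}
    (hf : MemLp f 2 (volume.restrict Ω)) (v : E d → E d) (q : E d → ℝ) :
    load Ω f (lump Ω 𝒯 v) =
      nodalPairing 𝒯 (fun p => ∫ x in Ω, (box Ω 𝒯 p).indicator f x) 0 v q := by
  have : IsFiniteMeasure (volume.restrict Ω) :=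
    ⟨by rw [Measure.restrict_apply_univ]; exact hbdd.measure_lt_top⟩
  have hfi : Integrable f (volume.restrict Ω) := hf.integrable (by norm_num)
  unfold load nodalPairing
  have e : ∀ x, inner ℝ (f x) (lump Ω 𝒯 v x) =
      ∑ p ∈ verts 𝒯, inner ℝ (v p) ((box Ω 𝒯 p).indicator f x) := by
    intro x
    rw [lump, inner_sum]
    refine Finset.sum_congr rfl fun p _ => ?_
    by_cases hx : x ∈ box Ω 𝒯 p
    · rw [Set.indicator_of_mem hx, Set.indicator_of_mem hx, real_inner_comm]
    · rw [Set.indicator_of_notMem hx, Set.indicator_of_notMem hx, inner_zero_right,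
        inner_zero_right]
  simp only [e]
  rw [integral_finsetSum]
  · refine Finset.sum_congr rfl fun p _ => ?_
    rw [integral_inner (hfi.indicator (measurableSet_box p)), real_inner_comm]
    simp
  · intro p _
    exact (hfi.indicator (measurableSet_box p)).const_inner _

end Residuals

/-! ### Definiteness of the box norm and boundedness of functionals on a fixed mesh -/

section Definiteness

variable {d : ℕ} {Ω : Set (E d)} {𝒯 : Finset (Finset (E d))}

theorem Vh.eq_zero_of_verts (h : IsTriangulation Ω 𝒯) {v : E d → ℝ} (hv : v ∈ Vh Ω 𝒯)
    (h0 : ∀ p ∈ verts 𝒯, v p = 0) : v = 0 := by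
  funext x
  by_cases hx : x ∈ closure Ω
  · rw [← h.union_eq] at hx
    obtain ⟨T, hT, hxT⟩ := Set.mem_iUnion₂.1 hx
    obtain ⟨φ, hφ⟩ := hv.2.1 T hT
    have hc : Convex ℝ (φ ⁻¹' {0}) := (convex_singleton 0).affine_preimage φ
    have := convexHull_min (fun p hp => by
      rw [Set.mem_preimage, Set.mem_singleton_iff, ← hφ (subset_simplex T hp)]
      exact h0 p (mem_verts.2 ⟨T, hT, hp⟩)) hc hxT
    rw [hφ hxT]
    exact this
  · exact hv.2.2 x hx

theorem VhVec.eq_zero_of_verts (h : IsTriangulation Ω 𝒯) {v : E d → E d} (hv : v ∈ VhVec Ω 𝒯)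
    (h0 : ∀ p ∈ verts 𝒯, v p = 0) : v = 0 := by
  funext x
  ext k
  exact congrFun (Vh.eq_zero_of_verts h (hv k) fun p hp => by simp [h0 p hp]) x

theorem frontier_nonempty (hd : 0 < d) (hne : Ω.Nonempty) (hbdd : Bornology.IsBounded Ω) :
    (frontier Ω).Nonempty := by
  rw [nonempty_frontier_iff]
  refine ⟨hne, fun hu => ?_⟩
  have : Nonempty (Fin d) := ⟨⟨0, hd⟩⟩
  rw [hu] at hbdd
  exact NormedSpace.unbounded_univ ℝ (E d) hbdd

/-- Such a function takes finitely many values on the connected set `closure Ω`, hence is constant;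
the frontier is nonempty, so the constant is zero. -/
theorem Vh.eq_zero_of_edges (hd : 0 < d) (hconn : IsConnected Ω) (hbdd : Bornology.IsBounded Ω)
    (h : IsTriangulation Ω 𝒯) {v : E d → ℝ} (hv : v ∈ Vh Ω 𝒯) (hb : ∀ x ∈ frontier Ω, v x = 0)
    (he : ∀ T ∈ 𝒯, ∀ p ∈ T, ∀ q ∈ T, v p = v q) : v = 0 := by
  have hfin : v '' closure Ω ⊆ v '' (verts 𝒯 : Set (E d)) := by
    rintro _ ⟨x, hx, rfl⟩
    rw [← h.union_eq] at hx
    obtain ⟨T, hT, hxT⟩ := Set.mem_iUnion₂.1 hx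
    obtain ⟨φ, hφ⟩ := hv.2.1 T hT
    obtain ⟨p, hp⟩ := h.nonempty_of_mem hT
    have hc : Convex ℝ (φ ⁻¹' {v p}) := (convex_singleton _).affine_preimage φ
    have := convexHull_min (fun q hq => by
      rw [Set.mem_preimage, Set.mem_singleton_iff, ← hφ (subset_simplex T hq)]
      exact he T hT q hq p hp) hc hxT
    refine ⟨p, mem_verts.2 ⟨T, hT, hp⟩, ?_⟩
    rw [hφ hxT]
    exact this.symm
  have hpre : IsPreconnected (v '' closure Ω) := hconn.isPreconnected.closure.image v hv.1
  have hsub : (v '' closure Ω).Subsingleton := by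
    by_contra hns
    rw [Set.not_subsingleton_iff] at hns
    obtain ⟨a, ha, b, hb, hab⟩ := hns.exists_lt
    exact Set.Icc_infinite hab
      (((verts 𝒯).finite_toSet.image v).subset ((hpre.Icc_subset ha hb).trans hfin))
  obtain ⟨x₀, hx₀⟩ := frontier_nonempty hd hconn.nonempty hbdd
  funext x
  by_cases hx : x ∈ closure Ω
  · rw [hsub ⟨x, hx, rfl⟩ ⟨x₀, frontier_subset_closure hx₀, rfl⟩, hb x₀ hx₀]; rfl
  · exact hv.2.2 x hx

theorem h1Seminorm_nonneg (v : E d → E d) : 0 ≤ h1Seminorm Ω v := Real.sqrt_nonneg _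

theorem l2Norm_nonneg (q : E d → ℝ) : 0 ≤ l2Norm Ω q := Real.sqrt_nonneg _

theorem boxNorm_nonneg (v : E d → E d) (q : E d → ℝ) : 0 ≤ boxNorm Ω 𝒯 v q := Real.sqrt_nonneg _

theorem boxNorm_sq (v : E d → E d) (q : E d → ℝ) : boxNorm Ω 𝒯 v q ^ 2 =
    h1Seminorm Ω v ^ 2 + l2Norm Ω (lump Ω 𝒯 q) ^ 2 + starNormMesh Ω 𝒯 q ^ 2 :=
  Real.sq_sqrt (by positivity)

theorem h1Seminorm_le_boxNorm (v : E d → E d) (q : E d → ℝ) :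
    h1Seminorm Ω v ≤ boxNorm Ω 𝒯 v q := by
  apply Real.le_sqrt_of_sq_le
  nlinarith [sq_nonneg (l2Norm Ω (lump Ω 𝒯 q)), sq_nonneg (starNormMesh Ω 𝒯 q)]

theorem l2Norm_le_boxNorm (v : E d → E d) (q : E d → ℝ) :
    l2Norm Ω (lump Ω 𝒯 q) ≤ boxNorm Ω 𝒯 v q := by
  apply Real.le_sqrt_of_sq_le
  nlinarith [sq_nonneg (h1Seminorm Ω v), sq_nonneg (starNormMesh Ω 𝒯 q)]

theorem volume_inter_pos (hopen : IsOpen Ω) {U : Set (E d)} (hU : IsOpen U)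
    (hne : (U ∩ closure Ω).Nonempty) : 0 < volume (U ∩ Ω) := by
  obtain ⟨x, hxU, hx⟩ := hne
  exact (hU.inter hopen).measure_pos volume (mem_closure_iff.1 hx U hU hxU)

theorem setIntegral_ge_of_const (hopen : IsOpen Ω) {U : Set (E d)}
    (hU : IsOpen U) {F : E d → ℝ} (hF : IntegrableOn F Ω) (hF0 : ∀ x, 0 ≤ F x) {c : ℝ}
    (hc : ∀ x ∈ U ∩ Ω, F x = c) : c * (volume (U ∩ Ω)).toReal ≤ ∫ x in Ω, F x := by
  have h1 : ∫ x in U ∩ Ω, F x = c * (volume (U ∩ Ω)).toReal := by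
    rw [setIntegral_congr_fun (hU.inter hopen).measurableSet (g := fun _ => c) hc,
      setIntegral_const, smul_eq_mul, mul_comm]
    rfl
  rw [← h1]
  exact setIntegral_mono_set hF (Filter.Eventually.of_forall hF0)
    (Set.inter_subset_right.eventuallyLE)

/-- Nodal values are bounded by the norm of the lumped function. -/
theorem exists_nodal_le_l2Norm (hopen : IsOpen Ω) (hbdd : Bornology.IsBounded Ω)
    (h : IsTriangulation Ω 𝒯) {p : E d} (hp : p ∈ verts 𝒯) :
    ∃ K : ℝ, 0 ≤ K ∧ ∀ q : E d → ℝ, |q p| ≤ K * l2Norm Ω (lump Ω 𝒯 q) := by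
  -- On a small ball p is the strictly nearest vertex, so the lumped function equals q(p) there. The
  -- part of the ball in Ω has positive volume m even if p lies on the boundary, which gives the
  -- constant 1/√m.
  obtain ⟨ρ, hρ, hball⟩ := Metric.eventually_nhds_iff_ball.1 (eventually_dist_lt (𝒯 := 𝒯) p)
  have hpos := volume_inter_pos hopen Metric.isOpen_ball
    ⟨p, Metric.mem_ball_self hρ, h.vert_mem_closure hp⟩
  have hfin : volume (Metric.ball p ρ ∩ Ω) < ⊤ :=
    (measure_mono Set.inter_subset_left).trans_lt measure_ball_lt_top
  set m := (volume (Metric.ball p ρ ∩ Ω)).toReal with hm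
  have hm0 : 0 < m := ENNReal.toReal_pos hpos.ne' hfin.ne
  refine ⟨(√m)⁻¹, by positivity, fun q => ?_⟩
  have : IsFiniteMeasure (volume.restrict Ω) :=
    ⟨by rw [Measure.restrict_apply_univ]; exact hbdd.measure_lt_top⟩
  have hmeas : Measurable (lump Ω 𝒯 q) :=
    Finset.measurable_fun_sum _ fun p _ => measurable_const.indicator (measurableSet_box p)
  have hbound : ∀ x, |lump Ω 𝒯 q x| ≤ ∑ p ∈ verts 𝒯, |q p| := by
    intro x
    refine (Finset.abs_sum_le_sum_abs _ _).trans (Finset.sum_le_sum fun p _ => ?_)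
    by_cases hx : x ∈ box Ω 𝒯 p
    · rw [Set.indicator_of_mem hx]
    · rw [Set.indicator_of_notMem hx, abs_zero]; exact abs_nonneg _
  have hinteg : IntegrableOn (fun x => lump Ω 𝒯 q x ^ 2) Ω := by
    refine Integrable.mono' (integrable_const ((∑ p ∈ verts 𝒯, |q p|) ^ 2))
      (hmeas.pow_const 2).aestronglyMeasurable (Filter.Eventually.of_forall fun x => ?_)
    rw [Real.norm_eq_abs, abs_pow]
    exact pow_le_pow_left₀ (abs_nonneg _) (hbound x) 2
  have key := setIntegral_ge_of_const hopen Metric.isOpen_ball hinteg (fun x => sq_nonneg _)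
    (c := q p ^ 2) (by
      rintro x ⟨hxb, hxΩ⟩
      have hx := hball x hxb
      have : lump Ω 𝒯 q x = q p := by
        rw [lump, Finset.sum_eq_single_of_mem p hp]
        · apply Set.indicator_of_mem
          refine ⟨fun r hr => ?_, subset_closure hxΩ⟩
          by_cases hrp : r = p
          · rw [hrp]
          · exact (hx r hr hrp).le
        · intro r hr hrp
          apply Set.indicator_of_notMem
          intro hxr
          exact absurd (hxr.1 p hp) (not_le.2 (hx r hr hrp))
      simp only [this])
  have h2 : l2Norm Ω (lump Ω 𝒯 q) ^ 2 = ∫ x in Ω, lump Ω 𝒯 q x ^ 2 :=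
    Real.sq_sqrt (integral_nonneg fun x => sq_nonneg _)
  rw [← h2] at key
  rw [inv_mul_eq_div, le_div_iff₀ (by positivity)]
  apply le_of_sq_le_sq _ (l2Norm_nonneg _)
  rw [mul_pow, sq_abs, Real.sq_sqrt hm0.le]
  exact key

/-- The gradient is constant on the interior of T, which meets Ω in positive volume; the edge jump
is at most this gradient times the diameter. The constant may depend on the mesh. -/
theorem exists_edge_le_h1Seminorm (hopen : IsOpen Ω) (hbdd : Bornology.IsBounded Ω)
    (h : IsTriangulation Ω 𝒯) {σ δ κ : ℝ} (hd : 0 < d) (hσ : 0 < σ)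
    (hreg : MeshRegular Ω 𝒯 σ δ κ) {T : Finset (E d)} (hT : T ∈ 𝒯) :
    ∃ K : ℝ, 0 ≤ K ∧ ∀ v ∈ VhVec Ω 𝒯, ∀ p ∈ T, ∀ q ∈ T, ‖v p - v q‖ ≤ K * h1Seminorm Ω v := by
  have hTpos := h.elemSize_pos hd hT
  obtain ⟨z, hz⟩ := hreg.shape T hT
  have hzint : z ∈ interior (simplex T) :=
    mem_interior_iff_mem_nhds.2 (Filter.mem_of_superset
      (Metric.closedBall_mem_nhds z (div_pos hTpos hσ)) hz)
  have hpos := volume_inter_pos hopen (isOpen_interior (s := simplex T))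
    ⟨z, hzint, h.simplex_subset hT (interior_subset hzint)⟩
  have hfin : volume (interior (simplex T) ∩ Ω) < ⊤ :=
    (measure_mono (Set.inter_subset_right)).trans_lt hbdd.measure_lt_top
  set m := (volume (interior (simplex T) ∩ Ω)).toReal with hm
  have hm0 : 0 < m := ENNReal.toReal_pos hpos.ne' hfin.ne
  have : IsFiniteMeasure (volume.restrict Ω) :=
    ⟨by rw [Measure.restrict_apply_univ]; exact hbdd.measure_lt_top⟩
  refine ⟨elemSize T * (√m)⁻¹, by positivity, fun v hv p hp q hq => ?_⟩
  have hk : ∀ k : Fin d, (v p k - v q k) ^ 2 ≤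
      elemSize T ^ 2 * (m⁻¹ * ∫ x in Ω, ‖fderiv ℝ (fun y => v y k) x‖ ^ 2) := by
    intro k
    obtain ⟨_, haff, _⟩ := hv k
    choose! φ hφ using haff
    have hinteg : IntegrableOn (fun x => ‖fderiv ℝ (fun y => v y k) x‖ ^ 2) Ω := by
      refine Integrable.mono'
        (integrable_const (∑ S ∈ 𝒯, ‖LinearMap.toContinuousLinearMap (φ S).linear‖ ^ 2))
        ((measurable_fderiv ℝ _).norm.pow_const 2).aestronglyMeasurable ?_
      filter_upwards [ae_restrict_of_ae_restrict_of_subset subset_closure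
        (ae_mem_interior_simplex h)] with x hx
      obtain ⟨S, hS, hxS⟩ := hx
      rw [Real.norm_of_nonneg (by positivity), fderiv_eq_of_mem_interior (hφ S hS) hxS]
      exact Finset.single_le_sum
        (f := fun S => ‖LinearMap.toContinuousLinearMap (φ S).linear‖ ^ 2)
        (fun _ _ => sq_nonneg _) hS
    have key := setIntegral_ge_of_const hopen (isOpen_interior (s := simplex T)) hinteg
      (fun x => sq_nonneg _) (c := ‖LinearMap.toContinuousLinearMap (φ T).linear‖ ^ 2) (by
        rintro x ⟨hx, _⟩
        simp only [fderiv_eq_of_mem_interior (hφ T hT) hx])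
    have h1 : v p k - v q k = LinearMap.toContinuousLinearMap (φ T).linear (p - q) := by
      have e1 : v p k = φ T p := hφ T hT (subset_simplex T hp)
      have e2 : v q k = φ T q := hφ T hT (subset_simplex T hq)
      rw [e1, e2]
      exact ((φ T).linearMap_vsub p q).symm
    have h2 := (LinearMap.toContinuousLinearMap (φ T).linear).le_opNorm (p - q)
    rw [← h1, ← dist_eq_norm p q, Real.norm_eq_abs] at h2
    have h3 : |v p k - v q k| ≤ ‖LinearMap.toContinuousLinearMap (φ T).linear‖ * elemSize T :=
      h2.trans (mul_le_mul_of_nonneg_left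
        (dist_le_elemSize (subset_simplex T hp) (subset_simplex T hq)) (norm_nonneg _))
    rw [← sq_abs]
    refine (pow_le_pow_left₀ (abs_nonneg _) h3 2).trans ?_
    rw [mul_pow, mul_comm]
    refine mul_le_mul_of_nonneg_left ?_ (by positivity)
    rw [inv_mul_eq_div, le_div_iff₀ hm0]
    exact key
  apply le_of_sq_le_sq _ (mul_nonneg (by positivity) (h1Seminorm_nonneg v))
  have hnn : 0 ≤ ∑ k : Fin d, ∫ x in Ω, ‖fderiv ℝ (fun y => v y k) x‖ ^ 2 :=
    Finset.sum_nonneg fun k _ => integral_nonneg fun x => by positivity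
  rw [mul_pow, mul_pow, inv_pow, Real.sq_sqrt hm0.le, h1Seminorm, Real.sq_sqrt hnn,
    EuclideanSpace.norm_sq_eq, mul_assoc, Finset.mul_sum, Finset.mul_sum]
  refine Finset.sum_le_sum fun k _ => ?_
  simpa using hk k

/-- On a fixed mesh, nodal values are bounded by the `H¹` seminorm. -/
theorem exists_nodal_le_h1Seminorm (hd : 0 < d) (hopen : IsOpen Ω) (hconn : IsConnected Ω)
    (hbdd : Bornology.IsBounded Ω) (h : IsTriangulation Ω 𝒯) {σ δ κ : ℝ} (hσ : 0 < σ)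
    (hreg : MeshRegular Ω 𝒯 σ δ κ) (p : E d) :
    ∃ K : ℝ, 0 ≤ K ∧ ∀ v ∈ VhVec0 Ω 𝒯, ‖v p‖ ≤ K * h1Seminorm Ω v := by
  classical
  have hedge : ∀ T ∈ 𝒯, ∃ K : ℝ, 0 ≤ K ∧ ∀ v ∈ VhVec Ω 𝒯, ∀ p ∈ T, ∀ q ∈ T,
      ‖v p - v q‖ ≤ K * h1Seminorm Ω v := fun T hT =>
    exists_edge_le_h1Seminorm hopen hbdd h hd hσ hreg hT
  choose! K hK0 hK using hedge
  -- A records all jumps along edges and is injective by connectedness. A linear left inverse,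
  -- automatically bounded in finite dimensions, recovers nodal values from jumps.
  let A : VhVec0 Ω 𝒯 →ₗ[ℝ] (𝒯 × verts 𝒯 × verts 𝒯 → E d) :=
    { toFun := fun v i => if (i.2.1 : E d) ∈ (i.1 : Finset (E d)) ∧ (i.2.2 : E d) ∈
        (i.1 : Finset (E d)) then (v : E d → E d) i.2.1 - (v : E d → E d) i.2.2 else 0
      map_add' := fun v w => by
        funext i
        simp only [Submodule.coe_add, Pi.add_apply]
        split_ifs
        · abel
        · simp
      map_smul' := fun c v => by
        funext i
        simp only [Submodule.coe_smul, Pi.smul_apply, RingHom.id_apply]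
        split_ifs
        · rw [smul_sub]
        · simp }
  have hAinj : LinearMap.ker A = ⊥ := by
    rw [LinearMap.ker_eq_bot']
    intro v hv
    apply Subtype.ext
    funext x
    ext k
    refine congrFun (Vh.eq_zero_of_edges hd hconn hbdd h (v.2.1 k)
      (fun x hx => by simp [v.2.2 x hx]) ?_) x
    intro T hT p hp q hq
    have h1 := congrFun hv (⟨T, hT⟩, ⟨p, mem_verts.2 ⟨T, hT, hp⟩⟩, ⟨q, mem_verts.2 ⟨T, hT, hq⟩⟩)
    have h2 : (v : E d → E d) p - (v : E d → E d) q = 0 := by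
      simpa [A, hp, hq] using h1
    rw [sub_eq_zero.1 h2]
  obtain ⟨g, hg⟩ := A.exists_leftInverse_of_injective hAinj
  let ev : VhVec0 Ω 𝒯 →ₗ[ℝ] E d :=
    { toFun := fun v => (v : E d → E d) p
      map_add' := fun _ _ => rfl
      map_smul' := fun _ _ => rfl }
  let F := LinearMap.toContinuousLinearMap (ev ∘ₗ g)
  have hKs : 0 ≤ ∑ T ∈ 𝒯, K T := Finset.sum_nonneg hK0
  refine ⟨‖F‖ * ∑ T ∈ 𝒯, K T, mul_nonneg (norm_nonneg _) hKs, fun v hv => ?_⟩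
  have h1 : v p = F (A ⟨v, hv⟩) := by
    have : g (A ⟨v, hv⟩) = ⟨v, hv⟩ := congrArg (fun L => L ⟨v, hv⟩) hg
    simp [F, ev, this]
  have h2 : ‖A ⟨v, hv⟩‖ ≤ (∑ T ∈ 𝒯, K T) * h1Seminorm Ω v := by
    rw [pi_norm_le_iff_of_nonneg (mul_nonneg hKs (h1Seminorm_nonneg v))]
    rintro ⟨T, a, b⟩
    by_cases hab : (a : E d) ∈ (T : Finset (E d)) ∧ (b : E d) ∈ (T : Finset (E d))
    · have : A ⟨v, hv⟩ (T, a, b) = v a - v b := by simp [A, hab]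
      rw [this]
      refine (hK T T.2 v hv.1 a hab.1 b hab.2).trans ?_
      exact mul_le_mul_of_nonneg_right
        (Finset.single_le_sum (f := K) hK0 T.2) (h1Seminorm_nonneg v)
    · have : A ⟨v, hv⟩ (T, a, b) = 0 := by simp only [A]; exact if_neg hab
      rw [this, norm_zero]
      exact mul_nonneg hKs (h1Seminorm_nonneg v)
  rw [h1, mul_assoc]
  exact (F.le_opNorm _).trans (mul_le_mul_of_nonneg_left h2 (norm_nonneg _))

/-- Functionals of the nodal values are bounded with respect to the norm of the box method. -/
theorem exists_nodalPairing_le (hd : 0 < d) (hopen : IsOpen Ω) (hconn : IsConnected Ω)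
    (hbdd : Bornology.IsBounded Ω) (h : IsTriangulation Ω 𝒯) {σ δ κ : ℝ} (hσ : 0 < σ)
    (hreg : MeshRegular Ω 𝒯 σ δ κ) (a : E d → E d) (b : E d → ℝ) :
    ∃ K : ℝ, 0 ≤ K ∧ ∀ v ∈ VhVec0 Ω 𝒯, ∀ q : E d → ℝ,
      |nodalPairing 𝒯 a b v q| ≤ K * boxNorm Ω 𝒯 v q := by
  choose K₁ hK₁ hb₁ using fun p => exists_nodal_le_h1Seminorm hd hopen hconn hbdd h hσ hreg p
  have hex : ∀ p ∈ verts 𝒯, ∃ K : ℝ, 0 ≤ K ∧ ∀ q : E d → ℝ, |q p| ≤ K * l2Norm Ω (lump Ω 𝒯 q) :=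
    fun p hp => exists_nodal_le_l2Norm hopen hbdd h hp
  choose! K₂ hK₂ hb₂ using hex
  refine ⟨∑ p ∈ verts 𝒯, (‖a p‖ * K₁ p + |b p| * K₂ p), Finset.sum_nonneg fun p hp =>
    add_nonneg (mul_nonneg (norm_nonneg _) (hK₁ p)) (mul_nonneg (abs_nonneg _) (hK₂ p hp)),
    fun v hv q => ?_⟩
  rw [nodalPairing, Finset.sum_mul]
  refine (Finset.abs_sum_le_sum_abs _ _).trans (Finset.sum_le_sum fun p hp => ?_)
  have h1 : |inner ℝ (a p) (v p)| ≤ ‖a p‖ * (K₁ p * boxNorm Ω 𝒯 v q) :=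
    (abs_real_inner_le_norm _ _).trans (mul_le_mul_of_nonneg_left ((hb₁ p v hv).trans
      (mul_le_mul_of_nonneg_left (h1Seminorm_le_boxNorm v q) (hK₁ p))) (norm_nonneg _))
  have h2 : |b p * q p| ≤ |b p| * (K₂ p * boxNorm Ω 𝒯 v q) := by
    rw [abs_mul]
    exact mul_le_mul_of_nonneg_left ((hb₂ p hp q).trans
      (mul_le_mul_of_nonneg_left (l2Norm_le_boxNorm v q) (hK₂ p hp))) (abs_nonneg _)
  refine (abs_add_le _ _).trans ((add_le_add h1 h2).trans (le_of_eq ?_))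
  ring

/-- A real `⨆` over an unbounded family is 0 by convention. Boundedness is what makes the supremum
dominate each quotient; the mesh-dependent bound does not enter γ. -/
theorem bddAbove_nodalPairing_div (hd : 0 < d) (hopen : IsOpen Ω) (hconn : IsConnected Ω)
    (hbdd : Bornology.IsBounded Ω) (h : IsTriangulation Ω 𝒯) {σ δ κ : ℝ} (hσ : 0 < σ)
    (hreg : MeshRegular Ω 𝒯 σ δ κ) (Qh : Submodule ℝ (E d → ℝ)) (a : E d → E d) (b : E d → ℝ) :
    BddAbove (Set.range fun t : VhVec0 Ω 𝒯 × Qh =>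
      nodalPairing 𝒯 a b (t.1 : E d → E d) (t.2 : E d → ℝ) /
        boxNorm Ω 𝒯 (t.1 : E d → E d) (t.2 : E d → ℝ)) := by
  obtain ⟨K, hK0, hK⟩ := exists_nodalPairing_le hd hopen hconn hbdd h hσ hreg a b
  refine ⟨K, ?_⟩
  rintro _ ⟨⟨v, q⟩, rfl⟩
  rcases (boxNorm_nonneg (Ω := Ω) (𝒯 := 𝒯) (v : E d → E d) (q : E d → ℝ)).eq_or_lt with h0 | h0
  · simp only [← h0, div_zero]; exact hK0
  · rw [div_le_iff₀ h0]
    exact (le_abs_self _).trans (hK v v.2 q)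

theorem eq_zero_of_boxNorm_eq_zero (hd : 0 < d) (hopen : IsOpen Ω) (hconn : IsConnected Ω)
    (hbdd : Bornology.IsBounded Ω) (h : IsTriangulation Ω 𝒯) {σ δ κ : ℝ} (hσ : 0 < σ)
    (hreg : MeshRegular Ω 𝒯 σ δ κ) {v : E d → E d} {q : E d → ℝ} (hv : v ∈ VhVec0 Ω 𝒯)
    (hq : q ∈ Vh Ω 𝒯) (h0 : boxNorm Ω 𝒯 v q = 0) : v = 0 ∧ q = 0 := by
  constructor
  · apply VhVec.eq_zero_of_verts h hv.1
    intro p _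
    obtain ⟨K, hK0, hK⟩ := exists_nodal_le_h1Seminorm hd hopen hconn hbdd h hσ hreg p
    have h1 := h1Seminorm_le_boxNorm (Ω := Ω) (𝒯 := 𝒯) v q
    rw [h0] at h1
    rw [← norm_le_zero_iff]
    exact (hK v hv).trans (mul_nonpos_of_nonneg_of_nonpos hK0 h1)
  · apply Vh.eq_zero_of_verts h hq
    intro p hp
    obtain ⟨K, hK0, hK⟩ := exists_nodal_le_l2Norm hopen hbdd h hp
    have h1 := l2Norm_le_boxNorm (Ω := Ω) (𝒯 := 𝒯) v q
    rw [h0] at h1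
    rw [← abs_nonpos_iff]
    exact (hK q).trans (mul_nonpos_of_nonneg_of_nonpos hK0 h1)

theorem finiteDimensional_VhVec0 (h : IsTriangulation Ω 𝒯) :
    FiniteDimensional ℝ (VhVec0 Ω 𝒯) := by
  let A : VhVec0 Ω 𝒯 →ₗ[ℝ] (verts 𝒯 → E d) :=
    { toFun := fun v i => (v : E d → E d) i
      map_add' := fun _ _ => rfl
      map_smul' := fun _ _ => rfl }
  refine Module.Finite.of_injective A (LinearMap.ker_eq_bot.1 (LinearMap.ker_eq_bot'.2 ?_))
  intro v hv
  exact Subtype.ext (VhVec.eq_zero_of_verts h v.2.1 fun p hp => congrFun hv ⟨p, hp⟩)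

theorem finiteDimensional_of_le_Vh (h : IsTriangulation Ω 𝒯) {Qh : Submodule ℝ (E d → ℝ)}
    (hQ : Qh ≤ Vh Ω 𝒯) : FiniteDimensional ℝ Qh := by
  let A : Qh →ₗ[ℝ] (verts 𝒯 → ℝ) :=
    { toFun := fun v i => (v : E d → ℝ) i
      map_add' := fun _ _ => rfl
      map_smul' := fun _ _ => rfl }
  refine Module.Finite.of_injective A (LinearMap.ker_eq_bot.1 (LinearMap.ker_eq_bot'.2 ?_))
  intro v hv
  exact Subtype.ext (Vh.eq_zero_of_verts h (hQ v.2) fun p hp => congrFun hv ⟨p, hp⟩)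

end Definiteness

/-! ### The inf-sup condition -/

section InfSup

variable {d : ℕ} {Ω : Set (E d)} {𝒯 : Finset (Finset (E d))}

/-- Replaces the local weight by the mesh size, so that (C1) controls the pressure seminorm in the
box norm. -/
theorem starNormMesh_sq_le (q : E d → ℝ) :
    starNormMesh Ω 𝒯 q ^ 2 ≤ meshSize 𝒯 ^ 3 * starNorm Ω 𝒯 q ^ 2 := by
  have hmesh : 0 ≤ meshSize 𝒯 := Real.sSup_nonneg (by
    rintro _ ⟨T, _, rfl⟩
    exact Metric.diam_nonneg)
  have hface0 : ∀ p q, 0 ≤ faceSize Ω 𝒯 p q := fun p q => Real.sSup_nonneg (by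
    rintro _ ⟨T, _, rfl⟩
    exact Metric.diam_nonneg)
  have hface : ∀ p q, faceSize Ω 𝒯 p q ≤ meshSize 𝒯 := fun p q => Real.sSup_le (by
    rintro _ ⟨T, hT, rfl⟩
    exact elemSize_le_meshSize hT.1) hmesh
  have hterm : ∀ p r, 0 ≤ dist p r * (area Ω 𝒯 p r * ‖normalDeriv p r q‖ ^ 2) := fun p r =>
    mul_nonneg dist_nonneg (mul_nonneg (area_nonneg p r) (sq_nonneg _))
  unfold starNormMesh starNorm
  rw [Real.sq_sqrt, Real.sq_sqrt]
  · rw [mul_left_comm]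
    refine mul_le_mul_of_nonneg_left ?_ (by norm_num)
    rw [Finset.mul_sum]
    refine Finset.sum_le_sum fun p _ => ?_
    rw [Finset.mul_sum]
    refine Finset.sum_le_sum fun r _ => ?_
    rw [mul_assoc]
    exact mul_le_mul_of_nonneg_right (pow_le_pow_left₀ (hface0 p r) (hface p r) 3) (hterm p r)
  · exact mul_nonneg (by norm_num)
      (Finset.sum_nonneg fun p _ => Finset.sum_nonneg fun r _ => hterm p r)
  · refine mul_nonneg (by norm_num)
      (Finset.sum_nonneg fun p _ => Finset.sum_nonneg fun r _ => ?_)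
    rw [mul_assoc]
    exact mul_nonneg (pow_nonneg (hface0 p r) 3) (hterm p r)

theorem lump_zero {M : Type*} [AddCommMonoid M] :
    lump Ω 𝒯 (0 : E d → M) = 0 := by
  funext x
  simp [lump]

theorem boxNorm_zero_right (v : E d → E d) : boxNorm Ω 𝒯 v 0 = h1Seminorm Ω v := by
  have h1 : l2Norm Ω (0 : E d → ℝ) = 0 := by simp [l2Norm]
  have h2 : starNormMesh Ω 𝒯 (0 : E d → ℝ) = 0 := by simp [starNormMesh, normalDeriv]
  rw [boxNorm, lump_zero, h1, h2]
  simp [Real.sqrt_sq (h1Seminorm_nonneg v)]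

theorem starNorm_neg (v : E d → E d) : starNorm Ω 𝒯 (-v) = starNorm Ω 𝒯 v := by
  unfold starNorm normalDeriv
  congr 2
  refine Finset.sum_congr rfl fun p _ => Finset.sum_congr rfl fun q _ => ?_
  rw [Pi.neg_apply, Pi.neg_apply, ← neg_sub', smul_neg, norm_neg]

theorem cB_neg (v : E d → E d) (w : E d → ℝ) : cB Ω 𝒯 (-v) w = - cB Ω 𝒯 v w := by
  unfold cB
  rw [← Finset.sum_neg_distrib]
  refine Finset.sum_congr rfl fun p _ => ?_
  rw [← neg_mul, neg_add, ← Finset.sum_neg_distrib, Pi.neg_apply, inner_neg_left]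
  congr 2
  refine Finset.sum_congr rfl fun q _ => ?_
  rw [Pi.neg_apply, smul_neg, smul_neg, ← neg_add, inner_neg_left, mul_neg]

/-- The energy identity. -/
theorem CB_self (hd : 0 < d) (hopen : IsOpen Ω) (hbdd : Bornology.IsBounded Ω)
    (h : IsTriangulation Ω 𝒯) (hin : InteriorBoxesInside Ω 𝒯) (ν : ℝ) {u : E d → E d}
    (hu : u ∈ VhVec0 Ω 𝒯) (r : E d → ℝ) :
    CB Ω 𝒯 ν u r (lump Ω 𝒯 u) (lump Ω 𝒯 r) =
      ν * starNorm Ω 𝒯 u ^ 2 + sB Ω 𝒯 ν r (lump Ω 𝒯 r) := by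
  rw [CB, aB_congr ν u fun p hp => lump_vert h u hp, bB_congr (fun p hp => lump_vert h u hp) r,
    cB_congr u fun p hp => lump_vert h r hp, bB_eq_neg_cB hd hopen hbdd h hin hu.2, aB_self]
  ring

theorem CB_velocity (hd : 0 < d) (hopen : IsOpen Ω) (hbdd : Bornology.IsBounded Ω)
    (h : IsTriangulation Ω 𝒯) (hin : InteriorBoxesInside Ω 𝒯) (ν : ℝ) (u : E d → E d)
    (r : E d → ℝ) {v : E d → E d} (hv : v ∈ VhVec0 Ω 𝒯) :
    CB Ω 𝒯 ν u r (lump Ω 𝒯 v) (lump Ω 𝒯 0) = aB Ω 𝒯 ν u v - cB Ω 𝒯 v (lump Ω 𝒯 r) := by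
  have h1 : cB Ω 𝒯 u (0 : E d → ℝ) = 0 := by simp [cB]
  have h2 : sB Ω 𝒯 ν r (0 : E d → ℝ) = 0 := by simp [sB]
  rw [CB, aB_congr ν u fun p hp => lump_vert h v hp, bB_congr (fun p hp => lump_vert h v hp) r,
    lump_zero, h1, h2, bB_eq_neg_cB hd hopen hbdd h hin hv.2,
    cB_congr v fun p hp => lump_vert h r hp]
  ring

/-- Elementary inequality behind the inf-sup condition. -/
theorem le_mul_of_sq_le {X S M D : ℝ} (hS : 0 ≤ S) (hM : 0 ≤ M) (hD : 0 ≤ D)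
    (h : X ^ 2 ≤ M * (S * X) + D * S ^ 2) : X ≤ (M + D + 1) * S := by
  by_contra! hlt
  have h0 : 0 ≤ (M + D + 1) * S := by positivity
  have hX : 0 < X := h0.trans_lt hlt
  -- If the claim fails then S ≤ X, so X² ≤ (M+D)·S·X, whereas X² > (M+D+1)·S·X.
  have hSX : S ≤ X := by nlinarith [mul_nonneg hM hS, mul_nonneg hD hS]
  nlinarith [mul_lt_mul_of_pos_left hlt hX, mul_nonneg hD (mul_nonneg hS (sub_nonneg.2 hSX)),
    mul_nonneg hS hX.le]

theorem exists_infSup (hd : 2 ≤ d) (hopen : IsOpen Ω) (hconn : IsConnected Ω)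
    (hbdd : Bornology.IsBounded Ω) {ν σ δ κ α β : ℝ} (hν : 0 < ν) (hσ : 0 < σ) (hδ : 0 < δ)
    (hκ : 0 < κ) (hα : 0 < α) (hβ : 0 < β) :
    ∃ γ : ℝ, 0 < γ ∧ ∀ 𝒯 : Finset (Finset (E d)), IsTriangulation Ω 𝒯 →
      InteriorBoxesInside Ω 𝒯 → MeshRegular Ω 𝒯 σ δ κ →
      ∀ Qh : Submodule ℝ (E d → ℝ), Qh ≤ Vh Ω 𝒯 → RhieChowCoercive Ω 𝒯 ν Qh α →
        RhieChowInfSup Ω 𝒯 ν Qh β → ∀ u ∈ VhVec0 Ω 𝒯, ∀ p ∈ Qh,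
        γ * boxNorm Ω 𝒯 u p ≤ ⨆ t : VhVec0 Ω 𝒯 × Qh,
          CB Ω 𝒯 ν u p (lump Ω 𝒯 (t.1 : E d → E d)) (lump Ω 𝒯 (t.2 : E d → ℝ)) /
            boxNorm Ω 𝒯 (t.1 : E d → E d) (t.2 : E d → ℝ) := by
  obtain ⟨C, hC, hCb⟩ := exists_h1Seminorm_le hd hopen hbdd hσ hδ hκ
  have hd0 : 0 < d := by omega
  -- M and D are the coefficients of S·X and S² once |u|_*², ‖Πp‖² and s are eliminated; the 3 comes
  -- from squaring a sum of three terms.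
  set M : ℝ := (C ^ 2 + 3 * ν ^ 2 / β ^ 2) / ν + (1 / α + 3 / β ^ 2) with hM
  set D : ℝ := 3 * C ^ 2 / β ^ 2 with hD
  have hM0 : 0 ≤ M := by positivity
  have hD0 : 0 ≤ D := by positivity
  refine ⟨(M + D + 1)⁻¹, by positivity, fun 𝒯 h hin hreg Qh hQ hcoer hinf u hu p hp => ?_⟩
  set S := ⨆ t : VhVec0 Ω 𝒯 × Qh,
    CB Ω 𝒯 ν u p (lump Ω 𝒯 (t.1 : E d → E d)) (lump Ω 𝒯 (t.2 : E d → ℝ)) /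
      boxNorm Ω 𝒯 (t.1 : E d → E d) (t.2 : E d → ℝ) with hS
  have hbound : ∀ v ∈ VhVec0 Ω 𝒯, ∀ q ∈ Qh,
      CB Ω 𝒯 ν u p (lump Ω 𝒯 v) (lump Ω 𝒯 q) ≤ S * boxNorm Ω 𝒯 v q := by
    intro v hv q hq
    rcases (boxNorm_nonneg (Ω := Ω) (𝒯 := 𝒯) v q).eq_or_lt with h0 | h0
    · obtain ⟨rfl, rfl⟩ := eq_zero_of_boxNorm_eq_zero hd0 hopen hconn hbdd h hσ hreg hv (hQ hq)
        h0.symm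
      rw [← h0, mul_zero, CB_eq_nodalPairing h]
      simp [nodalPairing]
    · rw [← div_le_iff₀ h0]
      have hB := bddAbove_nodalPairing_div hd0 hopen hconn hbdd h hσ hreg Qh
        (momentumResidual Ω 𝒯 ν u p) (massResidual Ω 𝒯 ν u p)
      simp only [← CB_eq_nodalPairing h] at hB
      exact le_ciSup hB (⟨v, hv⟩, ⟨q, hq⟩)
  have hS0 : 0 ≤ S := by
    have hB := bddAbove_nodalPairing_div hd0 hopen hconn hbdd h hσ hreg Qh
      (momentumResidual Ω 𝒯 ν u p) (massResidual Ω 𝒯 ν u p)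
    simp only [← CB_eq_nodalPairing h] at hB
    refine le_trans (le_of_eq ?_) (le_ciSup hB 0)
    simp [CB_eq_nodalPairing h, nodalPairing]
  set a := starNorm Ω 𝒯 u with ha
  set s := sB Ω 𝒯 ν p (lump Ω 𝒯 p) with hs
  set P := l2Norm Ω (lump Ω 𝒯 p) with hP
  set X := boxNorm Ω 𝒯 u p with hX
  have ha0 : 0 ≤ a := starNorm_nonneg u
  have hsp : starNormMesh Ω 𝒯 p ^ 2 ≤ s / α := by
    rw [le_div_iff₀' hα]
    exact (mul_le_mul_of_nonneg_left (starNormMesh_sq_le p) hα.le).trans (hcoer p hp)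
  have hs0 : 0 ≤ s := by
    have := (sq_nonneg _).trans hsp
    rwa [le_div_iff₀ hα, zero_mul] at this
  have h1 : ν * a ^ 2 + s ≤ S * X := by
    have := hbound u hu p hp
    rwa [CB_self hd0 hopen hbdd h hin ν hu] at this
  have h2 : β * P ≤ S * C + √s + ν * a := by
    -- The supremum in (C2) need not be attained, so a velocity within ε of it is used.
    apply le_of_forall_pos_le_add
    intro ε hε
    have h3 : β * P - √s - ε < ⨆ v : VhVec0 Ω 𝒯,
        cB Ω 𝒯 v (lump Ω 𝒯 p) / starNorm Ω 𝒯 (v : E d → E d) := by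
      have := hinf p hp
      linarith
    obtain ⟨⟨v, hv⟩, hlt⟩ := exists_lt_of_lt_ciSup h3
    simp only at hlt
    have hSC : 0 ≤ S * C := by positivity
    have hνa : 0 ≤ ν * a := by positivity
    rcases (starNorm_nonneg (Ω := Ω) (𝒯 := 𝒯) v).eq_or_lt with h0 | h0
    -- If |v|_* = 0 the quotient is 0 by convention, and the bound holds trivially.
    · rw [← h0, div_zero] at hlt
      linarith
    -- The sign makes c(v,p) appear positively: the form at (-v,0) equals a(u,-v) + c(v,p).
    · have hv' : -v ∈ VhVec0 Ω 𝒯 := (VhVec0 Ω 𝒯).neg_mem hv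
      have h4 := hbound (-v) hv' 0 Qh.zero_mem
      rw [CB_velocity hd0 hopen hbdd h hin ν u p hv', boxNorm_zero_right, cB_neg] at h4
      have h5 := hCb 𝒯 h hin hreg (-v) hv'
      have h6 := (neg_abs_le _).trans' (neg_le_neg (aB_le (Ω := Ω) (𝒯 := 𝒯) hν u (-v)))
      rw [starNorm_neg] at h5 h6
      have h7 := mul_le_mul_of_nonneg_left h5 hS0
      have h8 : cB Ω 𝒯 v (lump Ω 𝒯 p) / starNorm Ω 𝒯 v ≤ S * C + ν * a := by
        rw [div_le_iff₀ h0]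
        linarith
      linarith
  have h3 : X ^ 2 ≤ C ^ 2 * a ^ 2 + P ^ 2 + s / α := by
    rw [hX, boxNorm_sq]
    have h4 := pow_le_pow_left₀ (h1Seminorm_nonneg u) (hCb 𝒯 h hin hreg u hu) 2
    rw [mul_pow] at h4
    linarith
  have h4 : P ^ 2 ≤ 3 / β ^ 2 * (S ^ 2 * C ^ 2 + s + ν ^ 2 * a ^ 2) := by
    rw [div_mul_eq_mul_div, le_div_iff₀ (by positivity)]
    have h5 := pow_le_pow_left₀ (mul_nonneg hβ.le (l2Norm_nonneg _)) h2 2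
    have h6 := Real.sq_sqrt hs0
    nlinarith [sq_nonneg (S * C - √s), sq_nonneg (S * C - ν * a), sq_nonneg (√s - ν * a)]
  have h5 : X ^ 2 ≤ M * (S * X) + D * S ^ 2 := by
    have e : C ^ 2 * a ^ 2 + 3 / β ^ 2 * (S ^ 2 * C ^ 2 + s + ν ^ 2 * a ^ 2) + s / α =
        (C ^ 2 + 3 * ν ^ 2 / β ^ 2) / ν * (ν * a ^ 2) + (1 / α + 3 / β ^ 2) * s + D * S ^ 2 := by
      rw [hD]; field_simp; ring
    have e1 : ν * a ^ 2 ≤ S * X := by linarith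
    have e2 : s ≤ S * X := by nlinarith [sq_nonneg a]
    have e3 : (C ^ 2 + 3 * ν ^ 2 / β ^ 2) / ν * (ν * a ^ 2) ≤
        (C ^ 2 + 3 * ν ^ 2 / β ^ 2) / ν * (S * X) :=
      mul_le_mul_of_nonneg_left e1 (by positivity)
    have e4 : (1 / α + 3 / β ^ 2) * s ≤ (1 / α + 3 / β ^ 2) * (S * X) :=
      mul_le_mul_of_nonneg_left e2 (by positivity)
    rw [hM, add_mul]
    linarith
  rw [inv_mul_le_iff₀ (by positivity)]
  exact le_mul_of_sq_le hS0 hM0 hD0 h5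

end InfSup

/-! ### The box method as a linear equation in the dual space -/

section WellPosed

variable {d : ℕ} {Ω : Set (E d)} {𝒯 : Finset (Finset (E d))}

theorem nodalPairing_add (a : E d → E d) (b : E d → ℝ) (v w : E d → E d) (q r : E d → ℝ) :
    nodalPairing 𝒯 a b (v + w) (q + r) = nodalPairing 𝒯 a b v q + nodalPairing 𝒯 a b w r := by
  simp only [nodalPairing, ← Finset.sum_add_distrib]
  refine Finset.sum_congr rfl fun p _ => ?_
  rw [Pi.add_apply, Pi.add_apply, inner_add_right]
  ring

theorem nodalPairing_smul (a : E d → E d) (b : E d → ℝ) (c : ℝ) (v : E d → E d) (q : E d → ℝ) :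
    nodalPairing 𝒯 a b (c • v) (c • q) = c * nodalPairing 𝒯 a b v q := by
  simp only [nodalPairing, Finset.mul_sum]
  refine Finset.sum_congr rfl fun p _ => ?_
  rw [Pi.smul_apply, Pi.smul_apply, inner_smul_right, smul_eq_mul]
  ring

/-- `nodalPairing` as a linear functional on the discrete spaces. -/
def nodalFunctional (Ω : Set (E d)) (𝒯 : Finset (Finset (E d))) (Qh : Submodule ℝ (E d → ℝ))
    (a : E d → E d) (b : E d → ℝ) : (VhVec0 Ω 𝒯 × Qh) →ₗ[ℝ] ℝ where
  toFun t := nodalPairing 𝒯 a b (t.1 : E d → E d) (t.2 : E d → ℝ)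
  map_add' _ _ := nodalPairing_add a b _ _ _ _
  map_smul' c _ := nodalPairing_smul a b c _ _

/-- The form `C̃_B` as a linear map into the dual of the discrete spaces. -/
def formMap (h : IsTriangulation Ω 𝒯) (ν : ℝ) (Qh : Submodule ℝ (E d → ℝ)) :
    (VhVec0 Ω 𝒯 × Qh) →ₗ[ℝ] Module.Dual ℝ (VhVec0 Ω 𝒯 × Qh) where
  toFun t := nodalFunctional Ω 𝒯 Qh (momentumResidual Ω 𝒯 ν t.1 t.2) (massResidual Ω 𝒯 ν t.1 t.2)
  map_add' t s := by
    refine LinearMap.ext fun x => ?_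
    have := CB_add_smul h ν 1 (t.1 : E d → E d) (s.1 : E d → E d) (t.2 : E d → ℝ) (s.2 : E d → ℝ)
      (x.1 : E d → E d) (x.2 : E d → ℝ)
    simp only [CB_eq_nodalPairing h, one_smul, one_mul] at this
    exact this
  map_smul' c t := by
    refine LinearMap.ext fun x => ?_
    have := CB_add_smul h ν c 0 (t.1 : E d → E d) 0 (t.2 : E d → ℝ)
      (x.1 : E d → E d) (x.2 : E d → ℝ)
    rw [CB_zero_left h, zero_add, zero_add, zero_add] at this
    simp only [CB_eq_nodalPairing h] at this
    exact this

theorem formMap_apply (h : IsTriangulation Ω 𝒯) (ν : ℝ) (Qh : Submodule ℝ (E d → ℝ))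
    (t s : VhVec0 Ω 𝒯 × Qh) : formMap h ν Qh t s =
      CB Ω 𝒯 ν t.1 t.2 (lump Ω 𝒯 (s.1 : E d → E d)) (lump Ω 𝒯 (s.2 : E d → ℝ)) :=
  (CB_eq_nodalPairing h ν _ _ _ _).symm

/-- The box method in compact form, for the homogenised velocity. -/
theorem isSolution_iff (h : IsTriangulation Ω 𝒯) (ν : ℝ) (Qh : Submodule ℝ (E d → ℝ))
    (f : E d → E d) {g : E d → E d} (hg : g ∈ VhVec Ω 𝒯) (u : E d → E d) (p : E d → ℝ) :
    IsSolution Ω 𝒯 ν Qh f g u p ↔ u - g ∈ VhVec0 Ω 𝒯 ∧ p ∈ Qh ∧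
      ∀ v ∈ VhVec0 Ω 𝒯, ∀ q ∈ Qh, CB Ω 𝒯 ν (u - g) p (lump Ω 𝒯 v) (lump Ω 𝒯 q) =
        load Ω f (lump Ω 𝒯 v) - CB Ω 𝒯 ν g 0 (lump Ω 𝒯 v) (lump Ω 𝒯 q) := by
  have hsplit : ∀ v q, CB Ω 𝒯 ν u p (lump Ω 𝒯 v) (lump Ω 𝒯 q) =
      CB Ω 𝒯 ν g 0 (lump Ω 𝒯 v) (lump Ω 𝒯 q) +
        CB Ω 𝒯 ν (u - g) p (lump Ω 𝒯 v) (lump Ω 𝒯 q) := by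
    intro v q
    have := CB_add_smul h ν 1 g (u - g) 0 p v q
    rwa [one_smul, one_smul, add_sub_cancel, zero_add, one_mul] at this
  constructor
  · rintro ⟨h1, h2, h3, h4, h5⟩
    refine ⟨⟨(VhVec Ω 𝒯).sub_mem h1 hg, fun x hx => ?_⟩, h3, fun v hv q hq => ?_⟩
    · rw [Pi.sub_apply, h2 x hx, sub_self]
    · rw [eq_sub_iff_add_eq', ← hsplit, CB, h4 v hv, add_assoc, h5 q hq, add_zero]
  · rintro ⟨h1, h2, h3⟩
    have h4 : ∀ v ∈ VhVec0 Ω 𝒯, ∀ q ∈ Qh,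
        CB Ω 𝒯 ν u p (lump Ω 𝒯 v) (lump Ω 𝒯 q) = load Ω f (lump Ω 𝒯 v) := by
      intro v hv q hq
      rw [hsplit, h3 v hv q hq, add_sub_cancel]
    -- The compact equation separates into momentum and mass equations by taking q = 0 or v = 0.
    refine ⟨?_, fun x hx => ?_, h2, fun v hv => ?_, fun q hq => ?_⟩
    · have := (VhVec Ω 𝒯).add_mem h1.1 hg
      rwa [sub_add_cancel] at this
    · exact sub_eq_zero.1 (h1.2 x hx)
    · have := h4 v hv 0 Qh.zero_mem
      rw [lump_zero, CB] at this
      simpa [cB, sB] using this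
    · have := h4 0 (VhVec0 Ω 𝒯).zero_mem q hq
      rw [lump_zero, CB] at this
      simpa [aB, bB, load] using this

end WellPosed

end RCBM

end

/-! ### Assembly: inf-sup, unique solvability, stability -/

theorem mainTheorem2 (d : ℕ) (hd : d = 2 ∨ d = 3) (Ω : Set (RCBM.E d)) (hΩ_open : IsOpen Ω)
    (hΩ_conn : IsConnected Ω) (hΩ_bdd : Bornology.IsBounded Ω)
    (ν σ δ κ α β : ℝ) (hν : 0 < ν) (hσ : 0 < σ) (hδ : 0 < δ) (hκ : 0 < κ) (hα : 0 < α)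
    (hβ : 0 < β) :
    ∃ γ : ℝ, 0 < γ ∧
      ∀ 𝒯 : Finset (Finset (RCBM.E d)), RCBM.IsTriangulation Ω 𝒯 → RCBM.IsDelaunay 𝒯 →
        RCBM.InteriorBoxesInside Ω 𝒯 → RCBM.MeshRegular Ω 𝒯 σ δ κ →
      ∀ Qh : Submodule ℝ (RCBM.E d → ℝ), Qh ≤ RCBM.Vh Ω 𝒯 →
        RCBM.RhieChowCoercive Ω 𝒯 ν Qh α → RCBM.RhieChowInfSup Ω 𝒯 ν Qh β →
      (∀ u ∈ RCBM.VhVec0 Ω 𝒯, ∀ p ∈ Qh,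
        γ * RCBM.boxNorm Ω 𝒯 u p ≤
          ⨆ t : RCBM.VhVec0 Ω 𝒯 × Qh,
            RCBM.CB Ω 𝒯 ν u p (RCBM.lump Ω 𝒯 (t.1 : RCBM.E d → RCBM.E d))
                (RCBM.lump Ω 𝒯 (t.2 : RCBM.E d → ℝ)) /
              RCBM.boxNorm Ω 𝒯 (t.1 : RCBM.E d → RCBM.E d) (t.2 : RCBM.E d → ℝ)) ∧
      (∀ f : RCBM.E d → RCBM.E d,
        MeasureTheory.MemLp f 2 (MeasureTheory.volume.restrict Ω) →
        ∀ g ∈ RCBM.VhVec Ω 𝒯,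
          (∃! x : (RCBM.E d → RCBM.E d) × (RCBM.E d → ℝ),
            RCBM.IsSolution Ω 𝒯 ν Qh f g x.1 x.2) ∧
          ∀ u p, RCBM.IsSolution Ω 𝒯 ν Qh f g u p →
            γ * RCBM.boxNorm Ω 𝒯 (u - g) p ≤
              ⨆ t : RCBM.VhVec0 Ω 𝒯 × Qh,
                (RCBM.load Ω f (RCBM.lump Ω 𝒯 (t.1 : RCBM.E d → RCBM.E d)) -
                    RCBM.CB Ω 𝒯 ν g 0 (RCBM.lump Ω 𝒯 (t.1 : RCBM.E d → RCBM.E d))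
                      (RCBM.lump Ω 𝒯 (t.2 : RCBM.E d → ℝ))) /
                  RCBM.boxNorm Ω 𝒯 (t.1 : RCBM.E d → RCBM.E d) (t.2 : RCBM.E d → ℝ)) := by
  have hd2 : 2 ≤ d := by omega
  obtain ⟨γ, hγ, hmain⟩ :=
    RCBM.exists_infSup hd2 hΩ_open hΩ_conn hΩ_bdd hν hσ hδ hκ hα hβ
  refine ⟨γ, hγ, fun 𝒯 h _ hin hreg Qh hQ hcoer hinf => ?_⟩
  have hinfsup := hmain 𝒯 h hin hreg Qh hQ hcoer hinf
  refine ⟨hinfsup, fun f hf g hg => ⟨?_, fun u p hup => ?_⟩⟩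
  -- On the kernel every quotient vanishes, so the inf-sup inequality forces the box norm to be
  -- zero.
  · have hinj : LinearMap.ker (RCBM.formMap h ν Qh) = ⊥ := by
      rw [LinearMap.ker_eq_bot']
      rintro ⟨⟨w, hw⟩, ⟨p, hp⟩⟩ hz
      have h0 : ∀ t : RCBM.VhVec0 Ω 𝒯 × Qh,
          RCBM.CB Ω 𝒯 ν w p (RCBM.lump Ω 𝒯 (t.1 : RCBM.E d → RCBM.E d))
            (RCBM.lump Ω 𝒯 (t.2 : RCBM.E d → ℝ)) = 0 := by
        intro t
        rw [← RCBM.formMap_apply h ν Qh (⟨w, hw⟩, ⟨p, hp⟩) t, hz]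
        rfl
      have h1 := hinfsup w hw p hp
      simp only [h0, zero_div, ciSup_const] at h1
      have h2 : RCBM.boxNorm Ω 𝒯 w p = 0 :=
        le_antisymm (nonpos_of_mul_nonpos_right h1 hγ) (RCBM.boxNorm_nonneg w p)
      obtain ⟨rfl, rfl⟩ := RCBM.eq_zero_of_boxNorm_eq_zero (by omega) hΩ_open hΩ_conn hΩ_bdd h hσ
        hreg hw (hQ hp) h2
      rfl
    have := RCBM.finiteDimensional_VhVec0 h
    have := RCBM.finiteDimensional_of_le_Vh h hQ
    -- The space and its dual have equal finite dimension, so uniqueness yields existence.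
    have hsurj : Function.Surjective (RCBM.formMap h ν Qh) :=
      (LinearMap.injective_iff_surjective_of_finrank_eq_finrank
        Subspace.dual_finrank_eq.symm).1 (LinearMap.ker_eq_bot.1 hinj)
    obtain ⟨⟨⟨w, hw⟩, ⟨p, hp⟩⟩, hwp⟩ := hsurj
      (RCBM.nodalFunctional Ω 𝒯 Qh
          (fun p => ∫ x in Ω, (RCBM.box Ω 𝒯 p).indicator f x) 0 -
        RCBM.nodalFunctional Ω 𝒯 Qh (RCBM.momentumResidual Ω 𝒯 ν g 0)
          (RCBM.massResidual Ω 𝒯 ν g 0))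
    refine ⟨(g + w, p), ?_, ?_⟩
    · refine (RCBM.isSolution_iff h ν Qh f hg _ _).2 ?_
      simp only [add_sub_cancel_left]
      refine ⟨hw, hp, fun v hv q hq => ?_⟩
      have h1 := congrArg (fun L => L (⟨v, hv⟩, ⟨q, hq⟩)) hwp
      simp only [RCBM.formMap_apply, LinearMap.sub_apply] at h1
      rw [h1, RCBM.load_eq_nodalPairing hΩ_bdd hf v q, RCBM.CB_eq_nodalPairing h]
      rfl
    · rintro ⟨u, r⟩ hur
      obtain ⟨hu, hr, heq⟩ := (RCBM.isSolution_iff h ν Qh f hg u r).1 hur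
      have h1 : RCBM.formMap h ν Qh (⟨u - g, hu⟩, ⟨r, hr⟩) =
          RCBM.formMap h ν Qh (⟨w, hw⟩, ⟨p, hp⟩) := by
        rw [hwp]
        apply LinearMap.ext
        rintro ⟨⟨v, hv⟩, ⟨q, hq⟩⟩
        rw [RCBM.formMap_apply, heq v hv q hq, RCBM.load_eq_nodalPairing hΩ_bdd hf v q,
          RCBM.CB_eq_nodalPairing h]
        rfl
      have h2 := LinearMap.ker_eq_bot.1 hinj h1
      simp only [Prod.mk.injEq, Subtype.mk.injEq] at h2
      rw [← h2.1, ← h2.2, add_sub_cancel]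
  · obtain ⟨hu, hp, heq⟩ := (RCBM.isSolution_iff h ν Qh f hg u p).1 hup
    -- For the solution, the form at (u - g, p) coincides with the right-hand side functional, so
    -- the two suprema are equal.
    refine (hinfsup _ hu p hp).trans (le_of_eq ?_)
    congr 1
    funext t
    rw [heq t.1 t.1.2 t.2 t.2.2]
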